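/- **Setting.** Let $\mathbb{Q}(q)^\pi=\mathbb{Q}(q)[\pi]/(\pi^2-1)$. Let $(I,\cdot)$ be a super Cartan datum: $I$ is a finite set with a parity function $p:I\to\{0,1\}$ taking the value $1$ at least once, and $\cdot$ is a symmetric $\mathbb{Z}$-valued bilinear form on $\mathbb{Z}[I]$ with $d_i=\frac{i\cdot i}{2}\in\mathbb{Z}_{>0}$, $\frac{2\,i\cdot j}{i\cdot i}\in-\mathbb{N}$ for $i\ne j$, and $\frac{2\,i\cdot j}{i\cdot i}\in2\mathbb{Z}$ for all $j$ if $p(i)=1$. Let $Y,X$ be finitely generated free abelian groups with a perfect pairing $\langle\,,\rangle:Y\times X\to\mathbb{Z}$ and linearly independent families $(i)_{i\in I}$ in $Y$ and $(i')_{i\in I}$ in $X$ with $\langle i,j'\rangle=\frac{2\,i\cdot j}{i\cdot i}$. Put $q_i=q^{d_i}$, $\pi_i=\pi^{p(i)}$. Let ${}'\mathbf f$ be the free associative $\mathbb{Q}(q)^\pi$-algebra on $\theta_i$ $(i\in I)$, with weight grading $|\theta_i|=i$ and parity $p(\theta_i)=p(i)$. Let $r:{}'\mathbf f\to{}'\mathbf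 f\otimes{}'\mathbf f$ be the algebra homomorphism with $r(\theta_i)=\theta_i\otimes1+1\otimes\theta_i$, where the product on ${}'\mathbf f\otimes{}'\mathbf f$ is, on homogeneous elements, $(x_1\otimes x_2)(y_1\otimes y_2)=q^{|x_2|\cdot|y_1|}\pi^{p(x_2)p(y_1)}x_1y_1\otimes x_2y_2$. Let $(\,,)$ be the unique $\mathbb{Q}(q)^\pi$-bilinear form on ${}'\mathbf f$ with $(1,1)=1$, $(\theta_i,\theta_j)=\delta_{ij}(1-\pi_iq_i^{-2})^{-1}$, $(x,y'y'')=(r(x),y'\otimes y'')$ and $(xx',y)=(x\otimes x',r(y))$, where $(x_1\otimes x_2,y_1\otimes y_2)=(x_1,y_1)(x_2,y_2)$. Let $\mathcal I$ be its radical, a two-sided ideal, and $\mathbf f={}'\mathbf f/\mathcal I$. Let ${}'\mathbf U$ be the $\mathbb{Q}(q)^\pi$-algebra with generators $E_i,F_i$ $(i\in I)$, $J_\mu,K_\mu$ $(\mu\in Y)$ and relations, for all $i,j\in I$ and $\mu,\mu'\in Y$, - (a) $K_0=1$, $K_\mu K_{\mu'}=K_{\mu+\mu'}$; - (b) $J_{2\mu}=1$,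 $J_\mu J_{\mu'}=J_{\mu+\mu'}$; - (c) $J_\mu K_{\mu'}=K_{\mu'}J_\mu$; - (d) $K_\mu E_i=q^{\langle\mu,i'\rangle}E_iK_\mu$, $J_\mu E_i=\pi^{\langle\mu,i'\rangle}E_iJ_\mu$; - (e) $K_\mu F_i=q^{-\langle\mu,i'\rangle}F_iK_\mu$, $J_\mu F_i=\pi^{-\langle\mu,i'\rangle}F_iJ_\mu$; - (f) $E_iF_j-\pi^{p(i)p(j)}F_jE_i=\delta_{ij}\dfrac{J_{d_ii}K_{d_ii}-K_{-d_ii}}{\pi_iq_i-q_i^{-1}}$. Let $\mathbf U$ be the algebra with the same generators, the relations (a)–(f), and (g) $f(E_i:i\in I)=f(F_i:i\in I)=0$ for every $f(\theta_i:i\in I)\in\mathcal I$. Let $x\mapsto x^+$ and $x\mapsto x^-$ be the algebra homomorphisms ${}'\mathbf f\to{}'\mathbf U$ and $\mathbf f\to\mathbf U$ with $\theta_i^+=E_i$, $\theta_i^-=F_i$; let $\mathbf U^\pm\subseteq\mathbf U$ be the images of $\mathbf f$. Let $\mathbf U^0$ be the $\mathbb{Q}(q)^\pi$-algebra with generators $J_\mu,K_\mu$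 $(\mu\in Y)$ and relations (a), (b), (c). **Proposition.** There is an isomorphism of $\mathbb{Q}(q)^\pi$-algebras from $\mathbf U^0$ to the group algebra of $Y\times(Y/2Y)$ over $\mathbb{Q}(q)^\pi$ that sends $K_\mu$ to the group element $(\mu,0)$ and $J_\nu$ to $(0,\nu+2Y)$. Moreover the $\mathbb{Q}(q)^\pi$-linear maps $${}'\mathbf f\otimes\mathbf U^0\otimes{}'\mathbf f\to{}'\mathbf U,\qquad u\otimes J_\nu K_\mu\otimes w\mapsto u^-J_\nu K_\mu w^+\quad\text{and}\quad u\otimes J_\nu K_\mu\otimes w\mapsto u^+J_\nu K_\mu w^-$$ are isomorphisms. **Corollary.** Assume in addition that $i\cdot j\in2\mathbb{Z}$ for all $i,j\in I$ (this holds whenever $d_i\equiv p(i)\pmod 2$ for all $i$). Then the $\mathbb{Q}(q)^\pi$-linear maps $$\mathbf f\otimes\mathbf U^0\otimes\mathbf f\to\mathbf U,\qquad u\otimes J_\nu K_\mu\otimes w\mapsto u^-J_\nu K_\mu w^+\quad\text{and}\quad u\otimes J_\nu K_\mu\otimes w\mapsto u^+J_\nu K_\mu w^-$$ are isomorphisms.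 Hence $x\mapsto x^+$ and $x\mapsto x^-$ are isomorphisms of $\mathbb{Q}(q)^\pi$-algebras from $\mathbf f$ onto $\mathbf U^+$ and $\mathbf U^-$, and the canonical map $\mathbf U^0\to\mathbf U$ is an injective algebra homomorphism. -/

import Mathlib

open scoped TensorProduct

noncomputable section

namespace QuantumCovering

universe u v w

/-! ## The ground ring -/

/-- The ring `ℚ(q)^π = ℚ(q)[π] / (π² - 1)`. -/
def Qqpi : Type :=
  AdjoinRoot (Polynomial.X ^ 2 - 1 : Polynomial (RatFunc ℚ))

instance : CommRing Qqpi :=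
  inferInstanceAs (CommRing (AdjoinRoot (Polynomial.X ^ 2 - 1 : Polynomial (RatFunc ℚ))))

instance : Algebra (RatFunc ℚ) Qqpi :=
  inferInstanceAs
    (Algebra (RatFunc ℚ) (AdjoinRoot (Polynomial.X ^ 2 - 1 : Polynomial (RatFunc ℚ))))

/-- The parameter `q`, as a unit of `ℚ(q)^π`. -/
def q : Qqpiˣ :=
  Units.map (algebraMap (RatFunc ℚ) Qqpi : RatFunc ℚ →* Qqpi)
    (Units.mk0 RatFunc.X RatFunc.X_ne_zero)

theorem root_mul_root :
    (AdjoinRoot.root (Polynomial.X ^ 2 - 1 : Polynomial (RatFunc ℚ)) : Qqpi) *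
      (AdjoinRoot.root (Polynomial.X ^ 2 - 1 : Polynomial (RatFunc ℚ)) : Qqpi) = 1 := by
  have h := AdjoinRoot.mk_self (f := (Polynomial.X ^ 2 - 1 : Polynomial (RatFunc ℚ)))
  rw [map_sub, map_pow, map_one, AdjoinRoot.mk_X, sub_eq_zero] at h
  exact (sq _).symm.trans h

/-- The parameter `π`, as a unit of `ℚ(q)^π`; it is its own inverse. -/
def pi : Qqpiˣ where
  val := AdjoinRoot.root (Polynomial.X ^ 2 - 1 : Polynomial (RatFunc ℚ))
  inv := AdjoinRoot.root (Polynomial.X ^ 2 - 1 : Polynomial (RatFunc ℚ))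
  val_inv := root_mul_root
  inv_val := root_mul_root

/-! ## Super Cartan data and root data -/

/-- A super Cartan datum on the finite set `I`.  The symmetric bilinear form on `ℤ[I]` is given by
its values `dot i j = i · j` on the basis `I`, and the decomposition of `I` into even and odd
elements by the parity function `p`. -/
structure SuperCartanDatum (I : Type u) [Fintype I] where
  dot : I → I → ℤ
  dot_comm : ∀ i j, dot i j = dot j i
  p : I → Fin 2
  dot_self_even : ∀ i, Even (dot i i)
  dot_self_pos : ∀ i, 0 < dot i i
  /-- `2 (i · j) / (i · i) ∈ -ℕ` for `i ≠ j` -/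
  neg_int : ∀ i j, i ≠ j → ∃ n : ℕ, 2 * dot i j = -(n : ℤ) * dot i i
  exists_odd : ∃ i, p i = 1
  /-- `2 (i · j) / (i · i) ∈ 2ℤ` for `i` odd -/
  odd_even : ∀ i j, p i = 1 → ∃ m : ℤ, 2 * dot i j = (2 * m) * dot i i

namespace SuperCartanDatum

variable {I : Type u} [Fintype I] (C : SuperCartanDatum I)

/-- `d_i = (i · i) / 2` (an exact division) -/
def d (i : I) : ℤ := C.dot i i / 2

/-- `q_i = q ^ d_i` -/
def qi (i : I) : Qqpiˣ := q ^ C.d i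

/-- `π_i = π ^ p(i)` -/
def pii (i : I) : Qqpiˣ := pi ^ (C.p i : ℕ)

/-- The commutation factor `q ^ (i · j) π ^ (p(i) p(j))`. -/
def chi (i j : I) : Qqpi := ((q ^ C.dot i j * pi ^ ((C.p i : ℕ) * (C.p j : ℕ)) : Qqpiˣ) : Qqpi)

end SuperCartanDatum

/-- A root datum of type `C`: finitely generated free abelian groups `Y`, `X` in perfect duality,
with linearly independent families `i ↦ i ∈ Y` (`coroot`) and `i ↦ i' ∈ X` (`root`) such that
`⟨i, j'⟩ = 2 (i · j) / (i · i)`. -/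
structure SuperRootDatum {I : Type u} [Fintype I] (C : SuperCartanDatum I)
    (Y : Type v) (X : Type w) [AddCommGroup Y] [AddCommGroup X] where
  free_Y : Module.Free ℤ Y
  finite_Y : Module.Finite ℤ Y
  free_X : Module.Free ℤ X
  finite_X : Module.Finite ℤ X
  pairing : Y →ₗ[ℤ] X →ₗ[ℤ] ℤ
  perfect : pairing.IsPerfPair
  coroot : I → Y
  root : I → X
  coroot_indep : LinearIndependent ℤ coroot
  root_indep : LinearIndependent ℤ root
  pairing_coroot_root : ∀ i j, pairing (coroot i) (root j) * C.dot i i = 2 * C.dot i j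

/-! ## The twisted coproduct and the bilinear form on a free algebra

Here `R` is a commutative ring and `χ : I → I → R` a commutation factor on generators;
it will be specialised to `ℚ(q)^π` and `q ^ (i · j) π ^ (p(i) p(j))`. -/

section Free

variable {R : Type v} [CommRing R] {I : Type u}

/-- the generator `θ_i` -/
abbrev θ (i : I) : FreeAlgebra R I := FreeAlgebra.ι R i

/-- The algebra endomorphism `θ_j ↦ χ(i, j) θ_j`; it multiplies a weight vector `x` by
`χ(i, |x|)`. -/
def twist (χ : I → I → R) (i : I) : FreeAlgebra R I →ₐ[R] FreeAlgebra R I :=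
  FreeAlgebra.lift R fun j => χ i j • θ j

/-- Left multiplication by `1 ⊗ x` for the twisted multiplication on the tensor square:
`(1 ⊗ θ_i) (y ⊗ z) = χ(i, |y|) y ⊗ θ_i z`. -/
def rightLeg (χ : I → I → R) : FreeAlgebra R I →ₐ[R]
    Module.End R (FreeAlgebra R I ⊗[R] FreeAlgebra R I) :=
  FreeAlgebra.lift R fun i =>
    TensorProduct.map (twist χ i).toLinearMap (LinearMap.mulLeft R (θ i))

/-- The twisted multiplication on the tensor square of the free algebra,
`(x₁ ⊗ x₂) (y₁ ⊗ y₂) = χ(|x₂|, |y₁|) x₁ y₁ ⊗ x₂ y₂` for homogeneous elements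
(see `twistedMul_words`). -/
def twistedMul (χ : I → I → R) : FreeAlgebra R I ⊗[R] FreeAlgebra R I →ₗ[R]
    Module.End R (FreeAlgebra R I ⊗[R] FreeAlgebra R I) :=
  TensorProduct.lift <|
    ((LinearMap.mul R (Module.End R (FreeAlgebra R I ⊗[R] FreeAlgebra R I))).comp
      ((LinearMap.rTensorHom (FreeAlgebra R I)).comp
        (LinearMap.mul R (FreeAlgebra R I)))).compl₂ (rightLeg χ).toLinearMap

/-- The coproduct `r`: the map that is multiplicative for the twisted multiplication and sends
`θ_i` to `θ_i ⊗ 1 + 1 ⊗ θ_i` (see `coproduct_one`, `coproduct_gen`, `coproduct_mul`). -/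
def coproduct (χ : I → I → R) :
    FreeAlgebra R I →ₗ[R] FreeAlgebra R I ⊗[R] FreeAlgebra R I :=
  (LinearMap.applyₗ (1 ⊗ₜ[R] 1)).comp
    (FreeAlgebra.lift R fun i =>
      twistedMul χ (θ i ⊗ₜ[R] 1 + 1 ⊗ₜ[R] θ i)).toLinearMap

/-- The product of functionals transposed from the coproduct, `(g h)(x) = (g ⊗ h)(r(x))`. -/
def conv (χ : I → I → R) : Module.Dual R (FreeAlgebra R I) →ₗ[R]
    Module.Dual R (FreeAlgebra R I) →ₗ[R] Module.Dual R (FreeAlgebra R I) :=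
  LinearMap.mk₂ R
    (fun g h => (LinearMap.mul' R R).comp ((TensorProduct.map g h).comp (coproduct χ)))
    (by intros; ext; simp [TensorProduct.map_add_left])
    (by intros; ext; simp [TensorProduct.map_smul_left])
    (by intros; ext; simp [TensorProduct.map_add_right])
    (by intros; ext; simp [TensorProduct.map_smul_right])

/-- The augmentation `θ_i ↦ 0`. -/
def augmentation : FreeAlgebra R I →ₐ[R] R := FreeAlgebra.lift R fun _ => 0

open Classical in
/-- The functional reading off the coefficient of `θ_i`. -/
def coeffGen (i : I) : Module.Dual R (FreeAlgebra R I) :=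
  (TrivSqZeroExt.sndHom R R).comp
    (FreeAlgebra.lift R fun j =>
      (TrivSqZeroExt.inr (if i = j then 1 else 0) : TrivSqZeroExt R R)).toLinearMap

/-- The algebra map `φ` from the free algebra to its dual (with the product `conv` and the unit
`augmentation`) that sends `θ_i` to `c_i` times the coefficient functional of `θ_i`. -/
def toDual (χ : I → I → R) (c : I → R) :
    FreeAlgebra R I →ₗ[R] Module.Dual R (FreeAlgebra R I) :=
  (LinearMap.applyₗ (augmentation (R := R) (I := I)).toLinearMap).comp
    (FreeAlgebra.lift R fun i => conv χ (c i • coeffGen i)).toLinearMap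

/-- The bilinear form `(x, y) = φ(y)(x)` on the free algebra, with `(θ_i, θ_j) = δ_ij c_i`
(see `form_one_one`, `form_gen_gen`, `form_mul_right`, `form_mul_left`, and `form_unique`). -/
def form (χ : I → I → R) (c : I → R) : LinearMap.BilinForm R (FreeAlgebra R I) :=
  LinearMap.flip (toDual χ c)

/-! ### The defining properties of the coproduct and of the form -/

theorem induction_left {P : FreeAlgebra R I → Prop} (one : P 1)
    (add : ∀ x y, P x → P y → P (x + y)) (smul : ∀ (a : R) x, P x → P (a • x))
    (mul : ∀ i x, P x → P (θ i * x)) (x : FreeAlgebra R I) : P x := by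
  suffices h : ∀ x : FreeAlgebra R I, ∀ y, P y → P (x * y) by simpa using h x 1 one
  intro x
  refine FreeAlgebra.induction R I (motive := fun x => ∀ y, P y → P (x * y)) ?_ ?_ ?_ ?_ x
  · intro a y hy
    rw [← Algebra.smul_def]
    exact smul a y hy
  · exact fun i y hy => mul i y hy
  · intro a b ha hb y hy
    rw [mul_assoc]
    exact ha _ (hb _ hy)
  · intro a b ha hb y hy
    rw [add_mul]
    exact add _ _ (ha _ hy) (hb _ hy)

section Lemmas

variable (χ : I → I → R) (c : I → R)

@[simp] theorem twist_gen (i j : I) : twist χ i (θ j) = χ i j • θ j := by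
  simp [twist]

theorem twistedMul_tmul (x y : FreeAlgebra R I) :
    twistedMul χ (x ⊗ₜ[R] y) =
      (LinearMap.rTensor (FreeAlgebra R I) (LinearMap.mulLeft R x)).comp (rightLeg χ y) := by
  simp [twistedMul, Module.End.mul_eq_comp]
  rfl

/-- The twisted multiplication on words in the generators. -/
theorem twistedMul_words (x₁ x₂ y₁ y₂ : List I) :
    twistedMul χ ((x₁.map θ).prod ⊗ₜ[R] (x₂.map θ).prod) ((y₁.map θ).prod ⊗ₜ[R] (y₂.map θ).prod) =
      (x₂.map fun i => (y₁.map (χ i)).prod).prod •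
        (((x₁ ++ y₁).map θ).prod ⊗ₜ[R] ((x₂ ++ y₂).map θ).prod) := by
  have htw : ∀ (i : I) (l : List I),
      twist χ i (l.map θ).prod = (l.map (χ i)).prod • (l.map (θ (R := R))).prod := by
    intro i l
    induction l with
    | nil => simp
    | cons j l ih =>
      simp only [List.map_cons, List.prod_cons, map_mul, twist_gen, ih, smul_mul_smul_comm]
  have h : ∀ l : List I, rightLeg χ (l.map θ).prod ((y₁.map θ).prod ⊗ₜ[R] (y₂.map θ).prod) =
      (l.map fun i => (y₁.map (χ i)).prod).prod •
        ((y₁.map θ).prod ⊗ₜ[R] ((l ++ y₂).map θ).prod) := by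
    intro l
    induction l with
    | nil => simp
    | cons i l ih =>
      simp only [List.map_cons, List.prod_cons, map_mul, Module.End.mul_apply, ih, map_smul,
        List.cons_append]
      simp only [rightLeg, FreeAlgebra.lift_ι_apply, TensorProduct.map_tmul,
        AlgHom.toLinearMap_apply, htw, LinearMap.mulLeft_apply, ← TensorProduct.smul_tmul',
        smul_smul]
      rw [mul_comm]
  rw [twistedMul_tmul, LinearMap.comp_apply, h, map_smul, LinearMap.rTensor_tmul]
  simp

@[simp] theorem coproduct_one : coproduct χ (1 : FreeAlgebra R I) = 1 ⊗ₜ[R] 1 := by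
  simp [coproduct]

/-- Left multiplication by `r(θ_i)`. -/
theorem twistedMul_gen (i : I) :
    twistedMul χ (θ i ⊗ₜ[R] 1 + 1 ⊗ₜ[R] θ i) =
      TensorProduct.map (LinearMap.mulLeft R (θ i)) LinearMap.id +
        TensorProduct.map (twist χ i).toLinearMap (LinearMap.mulLeft R (θ i)) := by
  rw [map_add, twistedMul_tmul, twistedMul_tmul]
  ext x y
  simp [rightLeg]

theorem coproduct_gen_mul (i : I) (x : FreeAlgebra R I) :
    coproduct χ (θ i * x) =
      TensorProduct.map (LinearMap.mulLeft R (θ i)) LinearMap.id (coproduct χ x) +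
        TensorProduct.map (twist χ i).toLinearMap (LinearMap.mulLeft R (θ i)) (coproduct χ x) := by
  simp only [coproduct, LinearMap.comp_apply, AlgHom.toLinearMap_apply, map_mul,
    FreeAlgebra.lift_ι_apply]
  rw [twistedMul_gen]
  simp [Module.End.mul_apply]

theorem coproduct_gen (i : I) :
    coproduct χ (θ i) = θ i ⊗ₜ[R] 1 + 1 ⊗ₜ[R] θ i := by
  have h := coproduct_gen_mul χ i 1
  simpa using h

theorem coproduct_mul (x y : FreeAlgebra R I) :
    coproduct χ (x * y) = twistedMul χ (coproduct χ x) (coproduct χ y) := by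
  induction x using induction_left with
  | one => simp [twistedMul_tmul]
  | add x x' hx hx' => simp [add_mul, hx, hx']
  | smul a x hx => simp [hx]
  | mul i x hx =>
    rw [mul_assoc, coproduct_gen_mul, coproduct_gen_mul, hx, map_add, LinearMap.add_apply]
    generalize coproduct χ x = s
    generalize coproduct χ y = t
    induction s with
    | zero => simp
    | add s s' hs hs' =>
      simp only [map_add, LinearMap.add_apply] at hs hs' ⊢
      rw [add_add_add_comm, hs, hs', add_add_add_comm]
    | tmul a b =>
      simp only [TensorProduct.map_tmul, twistedMul_tmul, LinearMap.comp_apply,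
        LinearMap.mulLeft_apply, LinearMap.id_apply, map_mul, Module.End.mul_apply,
        AlgHom.toLinearMap_apply]
      congr 1
      · generalize rightLeg χ b t = t
        induction t with
        | zero => simp
        | add s s' hs hs' => simp only [map_add, hs, hs']
        | tmul a b => simp
      · generalize rightLeg χ b t = t
        induction t with
        | zero => simp
        | add s s' hs hs' => simp only [map_add, hs, hs']
        | tmul a b => simp [rightLeg]

theorem twist_comm (i j : I) (x : FreeAlgebra R I) :
    twist χ i (twist χ j x) = twist χ j (twist χ i x) := by
  have h : (twist χ i).comp (twist χ j) = (twist χ j).comp (twist χ i) := by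
    ext k
    simp [smul_smul, mul_comm]
  exact AlgHom.congr_fun h x

theorem twist_coproduct (i : I) (x : FreeAlgebra R I) :
    coproduct χ (twist χ i x) =
      TensorProduct.map (twist χ i).toLinearMap (twist χ i).toLinearMap (coproduct χ x) := by
  induction x using induction_left with
  | one => simp
  | add x x' hx hx' => simp [hx, hx']
  | smul a x hx => simp [hx]
  | mul j x hx =>
    rw [map_mul, twist_gen, smul_mul_assoc, map_smul, coproduct_gen_mul, coproduct_gen_mul, hx]
    generalize coproduct χ x = s
    induction s with
    | zero => simp
    | add s s' hs hs' =>
      simp only [map_add, smul_add] at hs hs' ⊢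
      rw [add_add_add_comm, hs, hs', add_add_add_comm]
    | tmul a b =>
      simp [TensorProduct.smul_tmul', twist_comm χ i j]

theorem coproduct_coassoc (x : FreeAlgebra R I) :
    TensorProduct.map (coproduct χ) LinearMap.id (coproduct χ x) =
      (TensorProduct.assoc R _ _ _).symm
        (TensorProduct.map LinearMap.id (coproduct χ) (coproduct χ x)) := by
  induction x using induction_left with
  | one => simp
  | add x x' hx hx' => simp only [map_add, hx, hx']
  | smul a x hx => simp only [map_smul, hx]
  | mul i x hx =>
    obtain ⟨M, hM⟩ : ∃ M : Module.End R
        ((FreeAlgebra R I ⊗[R] FreeAlgebra R I) ⊗[R] FreeAlgebra R I), ∀ z b,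
        M (z ⊗ₜ[R] b) =
          TensorProduct.map (LinearMap.mulLeft R (θ i)) LinearMap.id z ⊗ₜ[R] b +
          TensorProduct.map (twist χ i).toLinearMap (LinearMap.mulLeft R (θ i)) z ⊗ₜ[R] b +
          TensorProduct.map (twist χ i).toLinearMap (twist χ i).toLinearMap z ⊗ₜ[R] (θ i * b) :=
      ⟨TensorProduct.map (TensorProduct.map (LinearMap.mulLeft R (θ i)) LinearMap.id)
          LinearMap.id +
        TensorProduct.map (TensorProduct.map (twist χ i).toLinearMap
          (LinearMap.mulLeft R (θ i))) LinearMap.id +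
        TensorProduct.map (TensorProduct.map (twist χ i).toLinearMap (twist χ i).toLinearMap)
            (LinearMap.mulLeft R (θ i)), fun z b => by
          simp only [LinearMap.add_apply, TensorProduct.map_tmul, LinearMap.id_apply,
            LinearMap.mulLeft_apply]⟩
    have h₁ : ∀ s : FreeAlgebra R I ⊗[R] FreeAlgebra R I,
        TensorProduct.map (coproduct χ) LinearMap.id
          (TensorProduct.map (LinearMap.mulLeft R (θ i)) LinearMap.id s +
            TensorProduct.map (twist χ i).toLinearMap (LinearMap.mulLeft R (θ i)) s) =
        M (TensorProduct.map (coproduct χ) LinearMap.id s) := by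
      intro s
      induction s with
      | zero => simp
      | add s s' hs hs' =>
        simp only [map_add] at hs hs' ⊢
        rw [← hs, ← hs']
        abel
      | tmul a b =>
        simp [coproduct_gen_mul, twist_coproduct, hM, TensorProduct.add_tmul]
    have h₂ : ∀ s : FreeAlgebra R I ⊗[R] FreeAlgebra R I,
        (TensorProduct.assoc R _ _ _).symm (TensorProduct.map LinearMap.id (coproduct χ)
          (TensorProduct.map (LinearMap.mulLeft R (θ i)) LinearMap.id s +
            TensorProduct.map (twist χ i).toLinearMap (LinearMap.mulLeft R (θ i)) s)) =
        M ((TensorProduct.assoc R _ _ _).symm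
              (TensorProduct.map LinearMap.id (coproduct χ) s)) := by
      intro s
      induction s with
      | zero => simp
      | add s s' hs hs' =>
        simp only [map_add] at hs hs' ⊢
        rw [← hs, ← hs']
        abel
      | tmul a b =>
        simp only [map_add, TensorProduct.map_tmul, LinearMap.mulLeft_apply, LinearMap.id_apply,
          coproduct_gen_mul, AlgHom.toLinearMap_apply]
        generalize coproduct χ b = t
        induction t with
        | zero => simp
        | add s s' hs hs' =>
          simp only [map_add, TensorProduct.tmul_add] at hs hs' ⊢
          rw [← hs, ← hs']
          abel
        | tmul c d =>
          simp [TensorProduct.tmul_add, add_assoc, hM]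
    rw [coproduct_gen_mul, h₁, h₂, hx]

theorem conv_apply (g h : Module.Dual R (FreeAlgebra R I)) (x : FreeAlgebra R I) :
    conv χ g h x = LinearMap.mul' R R (TensorProduct.map g h (coproduct χ x)) := rfl

theorem conv_assoc (g h k : Module.Dual R (FreeAlgebra R I)) :
    conv χ (conv χ g h) k = conv χ g (conv χ h k) := by
  ext x
  have h₁ : ∀ s : FreeAlgebra R I ⊗[R] FreeAlgebra R I,
      LinearMap.mul' R R (TensorProduct.map (conv χ g h) k s) =
        LinearMap.mul' R R (TensorProduct.map ((LinearMap.mul' R R).comp (TensorProduct.map g h)) k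
          (TensorProduct.map (coproduct χ) LinearMap.id s)) := by
    intro s
    induction s with
    | zero => simp
    | add s s' hs hs' => simp only [map_add, hs, hs']
    | tmul a b => simp [conv_apply]
  have h₂ : ∀ s : FreeAlgebra R I ⊗[R] FreeAlgebra R I,
      LinearMap.mul' R R (TensorProduct.map g (conv χ h k) s) =
        LinearMap.mul' R R (TensorProduct.map ((LinearMap.mul' R R).comp (TensorProduct.map g h)) k
          ((TensorProduct.assoc R _ _ _).symm
            (TensorProduct.map LinearMap.id (coproduct χ) s))) := by
    intro s
    induction s with
    | zero => simp
    | add s s' hs hs' => simp only [map_add, hs, hs']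
    | tmul a b =>
      simp only [TensorProduct.map_tmul, conv_apply, LinearMap.id_apply, LinearMap.mul'_apply]
      generalize coproduct χ b = t
      induction t with
      | zero => simp
      | add s s' hs hs' => simp only [map_add, TensorProduct.tmul_add, mul_add, hs, hs']
      | tmul c d => simp [mul_assoc]
  rw [conv_apply, conv_apply, h₁, h₂, coproduct_coassoc]

theorem augmentation_twist (i : I) (x : FreeAlgebra R I) :
    augmentation (twist χ i x) = augmentation (R := R) x := by
  have h : (augmentation (R := R)).comp (twist χ i) = augmentation := by
    ext k
    simp [augmentation]
  exact AlgHom.congr_fun h x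

theorem augmentation_coproduct (x : FreeAlgebra R I) :
    TensorProduct.lid R _ (TensorProduct.map (augmentation (R := R) (I := I)).toLinearMap
      LinearMap.id (coproduct χ x)) = x := by
  induction x using induction_left with
  | one => simp
  | add x x' hx hx' => simp only [map_add, hx, hx']
  | smul a x hx => simp only [map_smul, hx]
  | mul i x hx =>
    rw [coproduct_gen_mul]
    conv_rhs => rw [← hx]
    generalize coproduct χ x = s
    induction s with
    | zero => simp
    | add s s' hs hs' =>
      simp only [map_add, mul_add] at hs hs' ⊢
      rw [← hs, ← hs']
      abel
    | tmul a b =>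
      have h0 : augmentation (R := R) (θ i) = 0 := by simp [augmentation]
      simp [augmentation_twist, h0]

theorem augmentation_conv (g : Module.Dual R (FreeAlgebra R I)) :
    conv χ (augmentation (R := R) (I := I)).toLinearMap g = g := by
  ext x
  conv_rhs => rw [← augmentation_coproduct χ x]
  rw [conv_apply]
  generalize coproduct χ x = s
  induction s with
  | zero => simp
  | add s s' hs hs' => simp only [map_add, hs, hs']
  | tmul a b => simp

theorem form_apply (x y : FreeAlgebra R I) : form χ c x y = toDual χ c y x := rfl

theorem toDual_one : toDual χ c 1 = (augmentation (R := R) (I := I)).toLinearMap := by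
  simp [toDual]

theorem toDual_gen_mul (i : I) (y : FreeAlgebra R I) :
    toDual χ c (θ i * y) = c i • conv χ (coeffGen i) (toDual χ c y) := by
  simp [toDual, Module.End.mul_apply]

theorem toDual_mul (y z : FreeAlgebra R I) :
    toDual χ c (y * z) = conv χ (toDual χ c y) (toDual χ c z) := by
  induction y using induction_left with
  | one => rw [one_mul, toDual_one, augmentation_conv]
  | add x x' hx hx' => simp [add_mul, hx, hx']
  | smul a x hx => simp [hx]
  | mul i x hx =>
    rw [mul_assoc, toDual_gen_mul, hx, toDual_gen_mul, map_smul, LinearMap.smul_apply, conv_assoc]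

theorem form_one_one : form χ c 1 1 = 1 := by simp [form_apply, toDual_one]

open Classical in
theorem form_gen_gen (i j : I) : form χ c (θ i) (θ j) = if i = j then c i else 0 := by
  have h := toDual_gen_mul χ c j 1
  rw [mul_one] at h
  rw [form_apply, h, LinearMap.smul_apply, conv_apply, coproduct_gen, toDual_one]
  by_cases hij : i = j
  · subst hij
    simp [coeffGen, augmentation]
  · simp [coeffGen, augmentation, hij, Ne.symm hij]

/-- `(x, y z) = (r(x), y ⊗ z)` -/
theorem form_mul_right (x y z : FreeAlgebra R I) :
    form χ c x (y * z) = (form χ c).tmul (form χ c) (coproduct χ x) (y ⊗ₜ[R] z) := by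
  rw [form_apply, toDual_mul, conv_apply]
  generalize coproduct χ x = s
  induction s with
  | zero => simp
  | add s s' hs hs' => simp only [map_add, LinearMap.add_apply, hs, hs']
  | tmul a b => simp [form_apply, mul_comm]

/-- The twisted derivation adjoint to left multiplication by `θ_i`. -/
def derivLeft (i : I) : FreeAlgebra R I →ₗ[R] FreeAlgebra R I :=
  (TensorProduct.lid R (FreeAlgebra R I)).toLinearMap.comp
    ((TensorProduct.map (coeffGen i) LinearMap.id).comp (coproduct χ))

theorem conv_coeffGen (i : I) (g : Module.Dual R (FreeAlgebra R I)) (x : FreeAlgebra R I) :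
    conv χ (coeffGen i) g x = g (derivLeft χ i x) := by
  simp only [conv_apply, derivLeft, LinearMap.comp_apply]
  generalize coproduct χ x = s
  induction s with
  | zero => simp
  | add s s' hs hs' => simp only [map_add, hs, hs']
  | tmul a b => simp

open Classical in
theorem coeffGen_gen_mul (i j : I) (x : FreeAlgebra R I) :
    coeffGen i (θ j * x) = (if i = j then augmentation x else 0) := by
  have h : (TrivSqZeroExt.fstHom R R R).comp (FreeAlgebra.lift R (fun j =>
      (TrivSqZeroExt.inr (if i = j then 1 else 0) : TrivSqZeroExt R R))) = augmentation := by
    ext k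
    by_cases hik : i = k
    · simp [augmentation, hik]
    · simp [augmentation, hik]
  have hx : TrivSqZeroExt.fst (FreeAlgebra.lift R (fun j =>
      (TrivSqZeroExt.inr (if i = j then 1 else 0) : TrivSqZeroExt R R)) x) = augmentation x :=
    AlgHom.congr_fun h x
  rw [coeffGen, LinearMap.comp_apply, AlgHom.toLinearMap_apply, map_mul, FreeAlgebra.lift_ι_apply,
    TrivSqZeroExt.sndHom_apply, TrivSqZeroExt.snd_mul, TrivSqZeroExt.fst_inr,
    TrivSqZeroExt.snd_inr, hx]
  simp

theorem coeffGen_twist (i j : I) (x : FreeAlgebra R I) :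
    coeffGen i (twist χ j x) = χ j i * coeffGen i x := by
  induction x using induction_left with
  | one => simp [coeffGen]
  | add x x' hx hx' => simp [hx, hx', mul_add]
  | smul a x hx => simp [hx, mul_left_comm]
  | mul k x hx =>
    rw [map_mul, twist_gen, smul_mul_assoc, map_smul, coeffGen_gen_mul, coeffGen_gen_mul,
      augmentation_twist]
    by_cases hik : i = k
    · simp [hik]
    · simp [hik]

open Classical in
theorem derivLeft_gen_mul (i j : I) (x : FreeAlgebra R I) :
    derivLeft χ i (θ j * x) =
      (if i = j then x else 0) + χ j i • (θ j * derivLeft χ i x) := by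
  have h₃ : x = TensorProduct.lid R _ (TensorProduct.map
      (augmentation (R := R) (I := I)).toLinearMap LinearMap.id (coproduct χ x)) :=
    (augmentation_coproduct χ x).symm
  have h₄ : (if i = j then x else 0) = TensorProduct.lid R _ (TensorProduct.map
      (if i = j then (augmentation (R := R) (I := I)).toLinearMap else 0)
        LinearMap.id (coproduct χ x)) := by
    by_cases hij : i = j
    · simpa [hij] using h₃
    · simp [hij]
  rw [h₄]
  simp only [derivLeft, LinearMap.comp_apply, coproduct_gen_mul]
  generalize coproduct χ x = s
  induction s with
  | zero => simp
  | add s s' hs hs' =>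
    simp only [map_add, mul_add, smul_add] at hs hs' ⊢
    rw [add_add_add_comm, hs, hs', add_add_add_comm]
  | tmul a b =>
    by_cases hij : i = j
    · simp [coeffGen_gen_mul, coeffGen_twist, hij, smul_smul]
    · simp [coeffGen_gen_mul, coeffGen_twist, hij, smul_smul]

theorem derivLeft_mul (hχ : ∀ i j, χ i j = χ j i) (i : I) (x y : FreeAlgebra R I) :
    derivLeft χ i (x * y) = derivLeft χ i x * y + twist χ i x * derivLeft χ i y := by
  induction x using induction_left with
  | one => simp [derivLeft, coeffGen]
  | add x x' hx hx' =>
    simp only [add_mul, map_add, hx, hx']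
    abel
  | smul a x hx => simp [hx]
  | mul j x hx =>
    rw [mul_assoc, derivLeft_gen_mul, derivLeft_gen_mul, hx, map_mul, twist_gen, hχ i j]
    by_cases hij : i = j
    · simp [hij, add_mul, mul_add, mul_assoc, add_assoc]
    · simp [hij, mul_add, mul_assoc]

theorem toDual_twist (i : I) (x y : FreeAlgebra R I) :
    toDual χ c (twist χ i y) x = toDual χ c y (twist χ i x) := by
  induction y using induction_left generalizing x with
  | one =>
    simp [toDual_one, augmentation_twist]
  | add y y' hy hy' => simp [hy, hy']
  | smul a y hy => simp [hy]
  | mul j y hy =>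
    have hd : ∀ x, derivLeft χ j (twist χ i x) = χ i j • twist χ i (derivLeft χ j x) := by
      classical
      intro x
      induction x using induction_left with
      | one => simp [derivLeft, coeffGen]
      | add x x' hx hx' => simp [hx, hx']
      | smul a x hx => simp [hx, smul_comm a]
      | mul k x hx =>
        rw [map_mul, twist_gen, smul_mul_assoc, map_smul, derivLeft_gen_mul, derivLeft_gen_mul, hx,
          map_add, map_smul, map_mul, twist_gen]
        by_cases hjk : j = k
        · simp [hjk, smul_smul, mul_comm]
        · simp [hjk, smul_smul, mul_comm, mul_left_comm]
    rw [map_mul, twist_gen, smul_mul_assoc, map_smul, toDual_gen_mul, toDual_gen_mul]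
    simp only [LinearMap.smul_apply, conv_coeffGen, hy, hd, map_smul]
    simp only [smul_eq_mul]
    ring

/-- `(x x', y) = (x ⊗ x', r(y))` -/
theorem form_mul_left (hχ : ∀ i j, χ i j = χ j i) (x x' y : FreeAlgebra R I) :
    form χ c (x * x') y = (form χ c).tmul (form χ c) (x ⊗ₜ[R] x') (coproduct χ y) := by
  induction y using induction_left generalizing x x' with
  | one => simp [form_apply, toDual_one, mul_comm]
  | add y y' hy hy' => simp [hy, hy']
  | smul a y hy => simp [hy]
  | mul i y hy =>
    have h : ∀ z w, form χ c z (θ i * w) = c i * form χ c (derivLeft χ i z) w := by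
      intro z w
      rw [form_apply, toDual_gen_mul, LinearMap.smul_apply, conv_coeffGen, form_apply, smul_eq_mul]
    rw [h, derivLeft_mul χ hχ, map_add, LinearMap.add_apply, hy, hy, coproduct_gen_mul]
    generalize coproduct χ y = s
    induction s with
    | zero => simp
    | add s s' hs hs' =>
      simp only [map_add, mul_add] at hs hs' ⊢
      rw [add_add_add_comm, hs, hs', add_add_add_comm]
    | tmul a b =>
      have ht : form χ c x (twist χ i a) = form χ c (twist χ i x) a := by
        rw [form_apply, form_apply, toDual_twist]
      simp [h, ht]
      ring

open Classical in
/-- The form is determined by its defining properties. -/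
theorem form_unique (B : LinearMap.BilinForm R (FreeAlgebra R I)) (one_one : B 1 1 = 1)
    (gen_gen : ∀ i j, B (θ i) (θ j) = if i = j then c i else 0)
    (mul_right : ∀ x y z, B x (y * z) = B.tmul B (coproduct χ x) (y ⊗ₜ[R] z))
    (mul_left : ∀ x x' y, B (x * x') y = B.tmul B (x ⊗ₜ[R] x') (coproduct χ y)) :
    B = form χ c := by
  have h₁ : ∀ i, B (θ i) 1 = 0 := by
    intro i
    have h := mul_right (θ i) 1 1
    simpa [coproduct_gen, one_one] using h
  have h₂ : ∀ i, B 1 (θ i) = 0 := by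
    intro i
    have h := mul_left 1 1 (θ i)
    simpa [coproduct_gen, one_one] using h
  have h₃ : ∀ x, B x 1 = augmentation x := by
    intro x
    induction x using induction_left with
    | one => simp [one_one]
    | add x x' hx hx' => simp [hx, hx']
    | smul a x hx => simp [hx]
    | mul i x hx =>
      rw [mul_left]
      simp [h₁, augmentation]
  have h₄ : ∀ x i, B x (θ i) = c i * coeffGen i x := by
    intro x i
    induction x using induction_left with
    | one => simp [h₂, coeffGen]
    | add x x' hx hx' => simp [hx, hx', mul_add]
    | smul a x hx => simp [hx, mul_left_comm]
    | mul j x hx =>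
      rw [mul_left, coproduct_gen, coeffGen_gen_mul]
      by_cases hij : i = j
      · simp [gen_gen, h₁, h₃, hij, mul_comm]
      · simp [gen_gen, h₁, hij, Ne.symm hij]
  have h₅ : ∀ y x, B x y = form χ c x y := by
    intro y
    induction y using induction_left with
    | one =>
      intro x
      rw [h₃, form_apply, toDual_one, AlgHom.toLinearMap_apply]
    | add y y' hy hy' => intro x; simp [hy, hy']
    | smul a y hy => intro x; simp [hy]
    | mul i y hy =>
      intro x
      rw [mul_right, form_apply, toDual_gen_mul, LinearMap.smul_apply, conv_apply]
      generalize coproduct χ x = s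
      induction s with
      | zero => simp
      | add s s' hs hs' => simp only [map_add, LinearMap.add_apply, smul_add, hs, hs']
      | tmul a b =>
        simp [h₄, hy, form_apply]
        ring
  ext x y
  simp [h₅]

end Lemmas

end Free

/-! ## The algebras `'f` and `f` -/

theorem pi_sq : pi ^ 2 = 1 := by
  ext
  exact (sq _).trans root_mul_root

theorem isUnit_q_pow_sub_one {n : ℤ} (hn : 0 < n) : IsUnit (((q ^ n : Qqpiˣ) : Qqpi) - 1) := by
  obtain ⟨m, rfl⟩ := Int.eq_ofNat_of_zero_le hn.le
  have h : ((q ^ ((m : ℕ) : ℤ) : Qqpiˣ) : Qqpi) - 1 =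
      algebraMap (RatFunc ℚ) Qqpi (RatFunc.X ^ m - 1) := by
    simp [q]
  rw [h]
  refine IsUnit.map _ (isUnit_iff_ne_zero.mpr fun h0 => ?_)
  rw [sub_eq_zero, ← RatFunc.algebraMap_X, ← map_pow,
    ← map_one (algebraMap (Polynomial ℚ) (RatFunc ℚ))] at h0
  have h1 := congrArg Polynomial.natDegree (RatFunc.algebraMap_injective ℚ h0)
  simp at h1
  omega

section Half

variable {I : Type u} [Fintype I] (C : SuperCartanDatum I)

theorem SuperCartanDatum.d_pos (i : I) : 0 < C.d i := by
  obtain ⟨k, hk⟩ := C.dot_self_even i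
  have := C.dot_self_pos i
  unfold SuperCartanDatum.d
  omega

theorem SuperCartanDatum.pii_sq (i : I) : C.pii i ^ 2 = 1 := by
  rw [SuperCartanDatum.pii, ← pow_mul, mul_comm, pow_mul, pi_sq, one_pow]

/-- `1 - π_i q_i⁻²` is invertible in `ℚ(q)^π`. -/
theorem isUnit_one_sub (i : I) :
    IsUnit (1 - ((C.pii i * C.qi i ^ (-2 : ℤ) : Qqpiˣ) : Qqpi)) := by
  have h := isUnit_q_pow_sub_one (n := C.d i * 4) (by have := C.d_pos i; omega)
  have h2 : ((q ^ (C.d i * 4) : Qqpiˣ) : Qqpi) - 1 =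
      (1 - ((C.pii i * C.qi i ^ (-2 : ℤ) : Qqpiˣ) : Qqpi)) *
        ((1 + ((C.pii i * C.qi i ^ (-2 : ℤ) : Qqpiˣ) : Qqpi)) *
          ((C.qi i ^ (4 : ℤ) : Qqpiˣ) : Qqpi)) := by
    have h3 : (C.pii i * C.qi i ^ (-2 : ℤ)) ^ 2 * C.qi i ^ (4 : ℤ) = 1 := by
      rw [mul_pow, C.pii_sq, one_mul, ← zpow_natCast, ← zpow_mul, ← zpow_add]
      norm_num
    have h4 : q ^ (C.d i * 4) = C.qi i ^ (4 : ℤ) := by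
      rw [SuperCartanDatum.qi, zpow_mul]
    have h5 := congrArg (Units.val) h3
    rw [Units.val_mul, Units.val_pow_eq_pow_val, Units.val_one] at h5
    rw [h4]
    linear_combination h5
  rw [h2] at h
  exact isUnit_of_mul_isUnit_left h

/-- `π_i q_i - q_i⁻¹` is invertible in `ℚ(q)^π`. -/
theorem isUnit_denominator (i : I) :
    IsUnit (((C.pii i * C.qi i : Qqpiˣ) : Qqpi) - (((C.qi i)⁻¹ : Qqpiˣ) : Qqpi)) := by
  have h := (C.pii i * C.qi i).isUnit.mul (isUnit_one_sub C i)
  have h1 : (C.pii i * C.qi i) * (C.pii i * C.qi i ^ (-2 : ℤ)) = (C.qi i)⁻¹ := by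
    have : (C.pii i * C.qi i) * (C.pii i * C.qi i ^ (-2 : ℤ)) =
        C.pii i ^ 2 * (C.qi i ^ (1 : ℤ) * C.qi i ^ (-2 : ℤ)) := by
      rw [zpow_one, sq, mul_mul_mul_comm]
    rw [this, C.pii_sq, one_mul, ← zpow_add]
    norm_num
  rwa [mul_sub, mul_one, ← Units.val_mul, h1] at h

/-- `'f`, the free associative `ℚ(q)^π`-algebra on the `θ_i`. -/
abbrev FreeHalf (I : Type u) : Type u := FreeAlgebra Qqpi I

/-- The bilinear form on `'f` with `(1, 1) = 1`, `(θ_i, θ_j) = δ_ij (1 - π_i q_i⁻²)⁻¹`,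
`(x, y'y'') = (r(x), y' ⊗ y'')` and `(xx', y'') = (x ⊗ x', r(y''))`. -/
def halfForm : LinearMap.BilinForm Qqpi (FreeHalf I) :=
  form C.chi fun i => Ring.inverse (1 - ((C.pii i * C.qi i ^ (-2 : ℤ) : Qqpiˣ) : Qqpi))

theorem SuperCartanDatum.chi_comm (i j : I) : C.chi i j = C.chi j i := by
  simp only [SuperCartanDatum.chi, C.dot_comm i j, mul_comm (C.p i : ℕ)]

/-- The radical `{x | (x, y) = 0 for all y}` of the form. -/
def radical : Ideal (FreeHalf I) where
  carrier := {x | ∀ y, halfForm C x y = 0}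
  zero_mem' := by simp
  add_mem' := by
    intro a b ha hb y
    simp [ha y, hb y]
  smul_mem' := by
    intro a x hx y
    rw [smul_eq_mul, halfForm, form_mul_left _ _ C.chi_comm]
    generalize coproduct C.chi y = s
    induction s with
    | zero => simp
    | add s s' hs hs' => rw [map_add, hs, hs', add_zero]
    | tmul b c =>
      have h := hx c
      rw [halfForm] at h
      rw [LinearMap.BilinForm.tmul, LinearMap.BilinForm.tensorDistrib_tmul, h, zero_smul]

instance : (radical C).IsTwoSided where
  mul_mem_of_left := by
    intro x a hx y
    rw [halfForm, form_mul_left _ _ C.chi_comm]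
    generalize coproduct C.chi y = s
    induction s with
    | zero => simp
    | add s s' hs hs' => rw [map_add, hs, hs', add_zero]
    | tmul b c =>
      have h := hx b
      rw [halfForm] at h
      rw [LinearMap.BilinForm.tmul, LinearMap.BilinForm.tensorDistrib_tmul, h, smul_zero]

/-- `f = 'f / radical` -/
abbrev Half : Type u := FreeHalf I ⧸ radical C

end Half

/-! ## The algebras `'U`, `U` and `U⁰` -/

/-- The generators `E_i`, `F_i`, `J_μ`, `K_μ`. -/
inductive Gen (I : Type u) (Y : Type v) : Type (max u v)
  | E (i : I)
  | F (i : I)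
  | J (μ : Y)
  | K (μ : Y)

/-- The generators `J_μ`, `K_μ`. -/
inductive Gen0 (Y : Type v) : Type v
  | J (μ : Y)
  | K (μ : Y)

section Algebras

variable {I : Type u} [Fintype I] {C : SuperCartanDatum I} {Y : Type v} {X : Type w}
  [AddCommGroup Y] [AddCommGroup X]

/-- The free algebra on the generators `E_i`, `F_i`, `J_μ`, `K_μ`. -/
abbrev FreeU (I : Type u) (Y : Type v) : Type (max u v) := FreeAlgebra Qqpi (Gen I Y)

namespace FreeU

def E (Y : Type v) (i : I) : FreeU I Y := FreeAlgebra.ι Qqpi (Gen.E i)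
def F (Y : Type v) (i : I) : FreeU I Y := FreeAlgebra.ι Qqpi (Gen.F i)
def J (I : Type u) (μ : Y) : FreeU I Y := FreeAlgebra.ι Qqpi (Gen.J μ)
def K (I : Type u) (μ : Y) : FreeU I Y := FreeAlgebra.ι Qqpi (Gen.K μ)

end FreeU

open FreeU

/-- The defining relations of `'U`. -/
inductive PreRel (D : SuperRootDatum C Y X) : FreeU I Y → FreeU I Y → Prop
  | K_zero : PreRel D (K I 0) 1
  | K_add (μ ν : Y) : PreRel D (K I μ * K I ν) (K I (μ + ν))
  | J_two (μ : Y) : PreRel D (J I (2 • μ)) 1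
  | J_add (μ ν : Y) : PreRel D (J I μ * J I ν) (J I (μ + ν))
  | J_K (μ ν : Y) : PreRel D (J I μ * K I ν) (K I ν * J I μ)
  | K_E (μ : Y) (i : I) : PreRel D (K I μ * E Y i)
      (((q ^ D.pairing μ (D.root i) : Qqpiˣ) : Qqpi) • (E Y i * K I μ))
  | J_E (μ : Y) (i : I) : PreRel D (J I μ * E Y i)
      (((pi ^ D.pairing μ (D.root i) : Qqpiˣ) : Qqpi) • (E Y i * J I μ))
  | K_F (μ : Y) (i : I) : PreRel D (K I μ * F Y i)
      (((q ^ (-D.pairing μ (D.root i)) : Qqpiˣ) : Qqpi) • (F Y i * K I μ))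
  | J_F (μ : Y) (i : I) : PreRel D (J I μ * F Y i)
      (((pi ^ (-D.pairing μ (D.root i)) : Qqpiˣ) : Qqpi) • (F Y i * J I μ))
  | E_F_same (i : I) : PreRel D
      (E Y i * F Y i - ((pi ^ ((C.p i : ℕ) * (C.p i : ℕ)) : Qqpiˣ) : Qqpi) • (F Y i * E Y i))
      (Ring.inverse (((C.pii i * C.qi i : Qqpiˣ) : Qqpi) - (((C.qi i)⁻¹ : Qqpiˣ) : Qqpi)) •
        (J I (C.d i • D.coroot i) * K I (C.d i • D.coroot i) - K I (-(C.d i • D.coroot i))))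
  | E_F_ne (i j : I) (hij : i ≠ j) : PreRel D
      (E Y i * F Y j - ((pi ^ ((C.p i : ℕ) * (C.p j : ℕ)) : Qqpiˣ) : Qqpi) • (F Y j * E Y i)) 0

/-- The defining relations of `U`: those of `'U`, and `f(E_i) = f(F_i) = 0` for every element
`f(θ_i)` of the radical of the form on `'f`. -/
inductive Rel (D : SuperRootDatum C Y X) : FreeU I Y → FreeU I Y → Prop
  | pre (x y : FreeU I Y) (h : PreRel D x y) : Rel D x y
  | radical_E (f : FreeHalf I) (hf : f ∈ radical C) : Rel D (FreeAlgebra.lift Qqpi (E Y) f) 0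
  | radical_F (f : FreeHalf I) (hf : f ∈ radical C) : Rel D (FreeAlgebra.lift Qqpi (F Y) f) 0

/-- The relations between the `J_μ` and the `K_μ`. -/
inductive ZeroRel (Y : Type v) [AddCommGroup Y] :
    FreeAlgebra Qqpi (Gen0 Y) → FreeAlgebra Qqpi (Gen0 Y) → Prop
  | K_zero : ZeroRel Y (FreeAlgebra.ι Qqpi (Gen0.K 0)) 1
  | K_add (μ ν : Y) : ZeroRel Y
      (FreeAlgebra.ι Qqpi (Gen0.K μ) * FreeAlgebra.ι Qqpi (Gen0.K ν))
      (FreeAlgebra.ι Qqpi (Gen0.K (μ + ν)))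
  | J_two (μ : Y) : ZeroRel Y (FreeAlgebra.ι Qqpi (Gen0.J (2 • μ))) 1
  | J_add (μ ν : Y) : ZeroRel Y
      (FreeAlgebra.ι Qqpi (Gen0.J μ) * FreeAlgebra.ι Qqpi (Gen0.J ν))
      (FreeAlgebra.ι Qqpi (Gen0.J (μ + ν)))
  | J_K (μ ν : Y) : ZeroRel Y
      (FreeAlgebra.ι Qqpi (Gen0.J μ) * FreeAlgebra.ι Qqpi (Gen0.K ν))
      (FreeAlgebra.ι Qqpi (Gen0.K ν) * FreeAlgebra.ι Qqpi (Gen0.J μ))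

/-- The algebra `'U`. -/
abbrev PreU (D : SuperRootDatum C Y X) : Type (max u v) := RingQuot (PreRel D)

/-- The quantum covering group `U`. -/
abbrev CoveringU (D : SuperRootDatum C Y X) : Type (max u v) := RingQuot (Rel D)

/-- The algebra `U⁰`. -/
abbrev UZero (Y : Type v) [AddCommGroup Y] : Type v := RingQuot (ZeroRel Y)

/-- `J_μ` in `U⁰` -/
def UZero.J (μ : Y) : UZero Y :=
  RingQuot.mkAlgHom Qqpi (ZeroRel Y) (FreeAlgebra.ι Qqpi (Gen0.J μ))

/-- `K_μ` in `U⁰` -/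
def UZero.K (μ : Y) : UZero Y :=
  RingQuot.mkAlgHom Qqpi (ZeroRel Y) (FreeAlgebra.ι Qqpi (Gen0.K μ))

variable (D : SuperRootDatum C Y X)

/-- `x ↦ x⁺`, `'f → 'U`, `θ_i ↦ E_i` -/
def prePlus : FreeHalf I →ₐ[Qqpi] PreU D :=
  (RingQuot.mkAlgHom Qqpi (PreRel D)).comp (FreeAlgebra.lift Qqpi (E Y))

/-- `x ↦ x⁻`, `'f → 'U`, `θ_i ↦ F_i` -/
def preMinus : FreeHalf I →ₐ[Qqpi] PreU D :=
  (RingQuot.mkAlgHom Qqpi (PreRel D)).comp (FreeAlgebra.lift Qqpi (F Y))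

/-- The inclusion of the generators `J_μ`, `K_μ` into all generators. -/
def freeZero (I : Type u) (Y : Type v) : FreeAlgebra Qqpi (Gen0 Y) →ₐ[Qqpi] FreeU I Y :=
  FreeAlgebra.lift Qqpi fun
    | Gen0.J μ => J I μ
    | Gen0.K μ => K I μ

theorem freeZero_rel {x y : FreeAlgebra Qqpi (Gen0 Y)} (h : ZeroRel Y x y) :
    PreRel D (freeZero I Y x) (freeZero I Y y) := by
  cases h with
  | K_zero => simpa [freeZero] using PreRel.K_zero
  | K_add μ ν => simpa [freeZero] using PreRel.K_add μ ν
  | J_two μ => simpa [freeZero] using PreRel.J_two μ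
  | J_add μ ν => simpa [freeZero] using PreRel.J_add μ ν
  | J_K μ ν => simpa [freeZero] using PreRel.J_K μ ν

/-- The canonical map `U⁰ → 'U`. -/
def preZero : UZero Y →ₐ[Qqpi] PreU D :=
  RingQuot.liftAlgHom Qqpi
    ⟨(RingQuot.mkAlgHom Qqpi (PreRel D)).comp (freeZero I Y), fun _ _ h =>
      RingQuot.mkAlgHom_rel Qqpi (freeZero_rel D h)⟩

/-- The canonical map `U⁰ → U`. -/
def zero : UZero Y →ₐ[Qqpi] CoveringU D :=
  RingQuot.liftAlgHom Qqpi
    ⟨(RingQuot.mkAlgHom Qqpi (Rel D)).comp (freeZero I Y), fun _ _ h =>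
      RingQuot.mkAlgHom_rel Qqpi (Rel.pre _ _ (freeZero_rel D h))⟩

/-- `x ↦ x⁺`, `f → U`, `θ_i ↦ E_i` -/
def plus : Half C →ₐ[Qqpi] CoveringU D :=
  Ideal.Quotient.liftₐ (radical C)
    ((RingQuot.mkAlgHom Qqpi (Rel D)).comp (FreeAlgebra.lift Qqpi (E Y))) fun f hf => by
      rw [AlgHom.comp_apply, RingQuot.mkAlgHom_rel Qqpi (Rel.radical_E f hf), map_zero]

/-- `x ↦ x⁻`, `f → U`, `θ_i ↦ F_i` -/
def minus : Half C →ₐ[Qqpi] CoveringU D :=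
  Ideal.Quotient.liftₐ (radical C)
    ((RingQuot.mkAlgHom Qqpi (Rel D)).comp (FreeAlgebra.lift Qqpi (F Y))) fun f hf => by
      rw [AlgHom.comp_apply, RingQuot.mkAlgHom_rel Qqpi (Rel.radical_F f hf), map_zero]

/-- `U⁺` -/
def UPlus : Subalgebra Qqpi (CoveringU D) := (plus D).range

/-- `U⁻` -/
def UMinus : Subalgebra Qqpi (CoveringU D) := (minus D).range

end Algebras

/-- The linear map `u ⊗ t ⊗ w ↦ a(u) b(t) c(w)` given by three algebra maps into one algebra. -/
def tripleMul {R : Type*} {A B A' U : Type*} [CommRing R] [Ring A] [Ring B] [Ring A'] [Ring U]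
    [Algebra R A] [Algebra R B] [Algebra R A'] [Algebra R U]
    (a : A →ₐ[R] U) (b : B →ₐ[R] U) (c : A' →ₐ[R] U) : (A ⊗[R] B) ⊗[R] A' →ₗ[R] U :=
  (LinearMap.mul' R U).comp
    (TensorProduct.map
      ((LinearMap.mul' R U).comp (TensorProduct.map a.toLinearMap b.toLinearMap)) c.toLinearMap)

/-- The subgroup `2Y` of `Y`. -/
def twoMul (Y : Type v) [AddCommGroup Y] : AddSubgroup Y := (nsmulAddMonoidHom 2 : Y →+ Y).range

end QuantumCovering

end

/-! The relations let every product be straightened into the order (lower part)(torus)(upper part),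
so each multiplication map should be onto; the difficulty is independence. It is obtained by
constructing the left regular representation in advance. On `N₁ ⊗ T ⊗ N₂`, a generator `B_i` of the
lower part multiplies the first factor, a torus element multiplies the second and rescales the
first, and `A_i` acts by the formula one finds on straightening `A_i y t x`. Moving `A_i` through a
word `y` in the `B_j` yields `y` rescaled times `A_i`, plus the sum over all ways of removing one
letter `B_i` from `y` and leaving a torus element in its place. Moving that element to the right of
`y` turns the sum into a skew derivation `skewDeriv` of `y`. The recursion `skewDeriv_gen_mul` is
exactly what the commutation relation of the operators demands (`rels_op`).

Once the operators define a representation `ρ` of the algebra, the multiplication map `φ` satisfies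
`ρ(φ(v))(1 ⊗ 1 ⊗ 1) = v`, so it is injective. It also intertwines `ρ(u)` with left multiplication by
`u`, so `u = φ(ρ(u)(1 ⊗ 1 ⊗ 1))` and it is surjective (`bijective_tripleMul`). The two orders of the
factors come from the same construction with the roles of `E` and `F` exchanged.

For `'U` the outer factors are free and nothing else is needed. For `U` the operators must descend
to the quotient by the radical, and elements of the radical in the `A_i` must act by zero. Both
follow if the radical is stable under the rescalings and the skew derivations that occur. Left and
right multiplication by `θ_i` are adjoint, up to an invertible constant, to skew derivations whose
two parameters have ratio `χ` in one direction or the other (`form_gen_mul_right`,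
`form_mul_gen_right`), and rescalings are self-adjoint (`form_scale`). Hence the radical is stable
under every skew derivation with that ratio. When all `i · j` are even, `J_{d_i i}` commutes with
all `E_j` and `F_j`, and the skew derivations coming from `J_{d_i i} K_{d_i i}` and `K_{-d_i i}`
have precisely this ratio (`stableQuotient_half`).

Injectivity of the separate factors then follows by applying counits to the remaining tensor
factors. -/

noncomputable section

namespace QuantumCovering

universe u v w

/-! ## Rescalings and skew derivations of a free algebra -/

section Skew

variable {R : Type*} [CommRing R] {I : Type*}

/-- The algebra endomorphism `θ_j ↦ φ_j θ_j`. -/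
def scale (φ : I → R) : FreeAlgebra R I →ₐ[R] FreeAlgebra R I :=
  FreeAlgebra.lift R fun j => φ j • θ j

@[simp] theorem scale_gen (φ : I → R) (j : I) : scale φ (θ j) = φ j • θ j := by
  simp [scale]

theorem scale_scale (φ φ' : I → R) (x : FreeAlgebra R I) :
    scale φ (scale φ' x) = scale (φ * φ') x := by
  have h : (scale φ).comp (scale φ') = scale (φ * φ') := by
    ext k
    simp [smul_smul, mul_comm]
  exact AlgHom.congr_fun h x

theorem scale_one_apply (x : FreeAlgebra R I) : scale (1 : I → R) x = x := by
  have h : scale (1 : I → R) = AlgHom.id R _ := by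
    ext k
    simp
  exact AlgHom.congr_fun h x

open Classical in
/-- The action of the free algebra on pairs `(x, d)` where `d` is the skew derivative of `x`. -/
def skewDerivAux (i : I) (α β : I → R) : FreeAlgebra R I →ₐ[R]
    Module.End R (FreeAlgebra R I × FreeAlgebra R I) :=
  FreeAlgebra.lift R fun j =>
    ((LinearMap.mulLeft R (θ j)).comp (LinearMap.fst R _ _)).prod
      (α j • (LinearMap.mulLeft R (θ j)).comp (LinearMap.snd R _ _) +
        if i = j then (scale β).toLinearMap.comp (LinearMap.fst R _ _) else 0)

/-- The linear map that removes, in all possible ways, one letter `θ_i` from a word; the letters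
before it are rescaled by `α` and those after it by `β`. -/
def skewDeriv (i : I) (α β : I → R) : FreeAlgebra R I →ₗ[R] FreeAlgebra R I :=
  (LinearMap.snd R _ _).comp
    ((LinearMap.applyₗ ((1, 0) : FreeAlgebra R I × FreeAlgebra R I)).comp
      (skewDerivAux i α β).toLinearMap)

/-- The pair has to carry the word itself, because the recursion for the derivative adds the
rescaled tail, which is a function of the word and not of its derivative. -/
theorem skewDerivAux_fst (i : I) (α β : I → R) (x : FreeAlgebra R I) :
    (skewDerivAux i α β x (1, 0)).1 = x := by
  induction x using induction_left with
  | one => simp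
  | add x x' hx hx' => simp [hx, hx']
  | smul a x hx => simp [hx]
  | mul j x hx =>
    rw [map_mul, Module.End.mul_apply]
    conv_rhs => rw [← hx]
    simp [skewDerivAux]

@[simp] theorem skewDeriv_one (i : I) (α β : I → R) : skewDeriv i α β 1 = 0 := by
  simp [skewDeriv]

open Classical in
theorem skewDeriv_gen_mul (i j : I) (α β : I → R) (x : FreeAlgebra R I) :
    skewDeriv i α β (θ j * x) =
      α j • (θ j * skewDeriv i α β x) + if i = j then scale β x else 0 := by
  have h : skewDeriv i α β (θ j * x) = α j • (θ j * skewDeriv i α β x) +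
      if i = j then scale β (skewDerivAux i α β x (1, 0)).1 else 0 := by
    simp only [skewDeriv, LinearMap.comp_apply, AlgHom.toLinearMap_apply, map_mul,
      LinearMap.applyₗ_apply_apply, Module.End.mul_apply]
    generalize skewDerivAux i α β x (1, 0) = z
    by_cases hij : i = j <;> simp [skewDerivAux, hij]
  rw [h, skewDerivAux_fst]

/-- The removed letter is already gone, so only the letters on either side are rescaled and both
parameters are multiplied by `φ`. Only the ratio of the parameters therefore matters for a subspace
that is stable under rescalings. -/
theorem scale_skewDeriv (i : I) (α β φ : I → R) (x : FreeAlgebra R I) :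
    scale φ (skewDeriv i α β x) = skewDeriv i (φ * α) (φ * β) x := by
  induction x using induction_left with
  | one => simp
  | add x x' hx hx' => simp [hx, hx']
  | smul a x hx => simp [hx]
  | mul j x hx =>
    rw [skewDeriv_gen_mul, skewDeriv_gen_mul, ← hx]
    by_cases hij : i = j <;> simp [hij, scale_scale, smul_smul, mul_comm]

/-- The removed letter was rescaled before it disappeared; it leaves the factor `φ i`. -/
theorem skewDeriv_scale (i : I) (α β φ : I → R) (x : FreeAlgebra R I) :
    skewDeriv i α β (scale φ x) = φ i • scale φ (skewDeriv i α β x) := by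
  induction x using induction_left with
  | one => simp
  | add x x' hx hx' => simp [hx, hx']
  | smul a x hx => simp [hx, smul_comm a]
  | mul j x hx =>
    rw [map_mul, scale_gen, smul_mul_assoc, map_smul, skewDeriv_gen_mul, skewDeriv_gen_mul, hx]
    by_cases hij : i = j
    · subst hij
      simp [scale_scale, smul_smul, mul_comm, mul_left_comm]
    · simp [hij, smul_smul, mul_comm, mul_left_comm]

end Skew

/-! ## Descending linear maps along a surjection -/

section Descend

variable {R M N : Type*} [CommRing R] [AddCommGroup M] [Module R M] [AddCommGroup N] [Module R N]

/-- The endomorphism of a quotient induced by an endomorphism that preserves the kernel. -/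
def descend (p : M →ₗ[R] N) (hp : Function.Surjective p) (f : M →ₗ[R] M)
    (hf : ∀ x, p x = 0 → p (f x) = 0) : N →ₗ[R] N :=
  ((LinearMap.ker p).liftQ (p.comp f)
    (fun x hx => LinearMap.mem_ker.2 (hf x (LinearMap.mem_ker.1 hx)))).comp
    (p.quotKerEquivOfSurjective hp).symm.toLinearMap

theorem descend_apply (p : M →ₗ[R] N) (hp : Function.Surjective p) (f : M →ₗ[R] M)
    (hf : ∀ x, p x = 0 → p (f x) = 0) (x : M) : descend p hp f hf (p x) = p (f x) := by
  have h : (p.quotKerEquivOfSurjective hp).symm (p x) = (LinearMap.ker p).mkQ x := by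
    rw [LinearEquiv.symm_apply_eq]
    rfl
  simp only [descend, LinearMap.comp_apply, LinearEquiv.coe_coe, h]
  rw [Submodule.mkQ_apply, Submodule.liftQ_apply, LinearMap.comp_apply]

end Descend

/-! ## Triangular data -/

/-- The data from which an algebra `N₁ ⊗ T ⊗ N₂` is built: generators `B_i` of `N₁` and `A_i` of
`N₂` with `A_i B_j - ε_ij B_j A_i = δ_ij ∑_k coeff_ik g(elt_ik)`, and a spanning monoid `g(Γ)` of
`T` whose elements commute with the generators up to the scalars `ψ`. -/
structure TriangularDatum (R I κ Γ T N₁ N₂ : Type*) [CommRing R] [CommMonoid Γ]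
    [Ring T] [Algebra R T] [Ring N₁] [Algebra R N₁] [Ring N₂] [Algebra R N₂] where
  ε : I → I → R
  ψ : Γ →* (I → Rˣ)
  g : Γ →* T
  span_g : Submodule.span R (Set.range g) = ⊤
  s : I → T →ₐ[R] T
  s_g : ∀ i γ, s i (g γ) = (((ψ γ i)⁻¹ : Rˣ) : R) • g γ
  coeff : I → κ → R
  elt : I → κ → Γ
  lower : FreeAlgebra R I →ₐ[R] N₁
  upper : FreeAlgebra R I →ₐ[R] N₂
  lower_surj : Function.Surjective lower
  upper_surj : Function.Surjective upper
  scale_lower : ∀ φ x, lower x = 0 → lower (scale φ x) = 0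
  scale_upper : ∀ φ x, upper x = 0 → upper (scale φ x) = 0
  -- These two skew derivations are the ones produced by moving `A_i` rightwards through a word in
  -- the `B_j`, and `B_i` leftwards through a word in the `A_j`.
  deriv_lower : ∀ i k x, lower x = 0 →
    lower (skewDeriv i (ε i) (fun j => (((ψ (elt i k) j)⁻¹ : Rˣ) : R)) x) = 0
  deriv_upper : ∀ i k x, upper x = 0 →
    upper (skewDeriv i (fun j => (((ψ (elt i k) j)⁻¹ : Rˣ) : R)) (fun j => ε j i) x) = 0

namespace TriangularDatum

variable {R I κ Γ T N₁ N₂ : Type*} [CommRing R] [CommMonoid Γ]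
    [Ring T] [Algebra R T] [Ring N₁] [Algebra R N₁] [Ring N₂] [Algebra R N₂]

/-- The inverse character of `γ`. -/
def wt (P : TriangularDatum R I κ Γ T N₁ N₂) (γ : Γ) (j : I) : R := ((P.ψ γ j)⁻¹ : Rˣ)

variable (P : TriangularDatum R I κ Γ T N₁ N₂)

/-- The rescaling of `N₁`. -/
def scaleLower (φ : I → R) : N₁ →ₗ[R] N₁ :=
  descend P.lower.toLinearMap P.lower_surj (scale φ).toLinearMap (P.scale_lower φ)

/-- The skew derivation of `N₁`. -/
def derivLower (i : I) (k : κ) : N₁ →ₗ[R] N₁ :=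
  descend P.lower.toLinearMap P.lower_surj (skewDeriv i (P.ε i) (P.wt (P.elt i k)))
    (P.deriv_lower i k)

theorem scaleLower_apply (φ : I → R) (x : FreeAlgebra R I) :
    P.scaleLower φ (P.lower x) = P.lower (scale φ x) :=
  descend_apply P.lower.toLinearMap P.lower_surj _ _ x

theorem derivLower_apply (i : I) (k : κ) (x : FreeAlgebra R I) :
    P.derivLower i k (P.lower x) = P.lower (skewDeriv i (P.ε i) (P.wt (P.elt i k)) x) :=
  descend_apply P.lower.toLinearMap P.lower_surj _ _ x

/-- The action of `B_i` on `N₁ ⊗ T ⊗ N₂`. -/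
def opB (i : I) : Module.End R ((N₁ ⊗[R] T) ⊗[R] N₂) :=
  TensorProduct.map (TensorProduct.map (LinearMap.mulLeft R (P.lower (θ i))) LinearMap.id)
    LinearMap.id

/-- The action of `g(γ)` on `N₁ ⊗ T ⊗ N₂`. -/
def opG (γ : Γ) : Module.End R ((N₁ ⊗[R] T) ⊗[R] N₂) :=
  TensorProduct.map (TensorProduct.map (P.scaleLower (P.wt γ)) (LinearMap.mulLeft R (P.g γ)))
    LinearMap.id

theorem opB_tmul (i : I) (y : FreeAlgebra R I) (t : T) (x : N₂) :
    P.opB i ((P.lower y ⊗ₜ t) ⊗ₜ x) = (P.lower (θ i * y) ⊗ₜ t) ⊗ₜ x := by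
  simp [opB]

theorem opG_tmul (γ : Γ) (y : FreeAlgebra R I) (t : T) (x : N₂) :
    P.opG γ ((P.lower y ⊗ₜ t) ⊗ₜ x) = (P.lower (scale (P.wt γ) y) ⊗ₜ (P.g γ * t)) ⊗ₜ x := by
  simp [opG, scaleLower_apply]

variable {P} in
theorem hom_ext {M : Type*} [AddCommGroup M] [Module R M]
    {f f' : (N₁ ⊗[R] T) ⊗[R] N₂ →ₗ[R] M}
    (h : ∀ y t x, f ((P.lower y ⊗ₜ t) ⊗ₜ x) = f' ((P.lower y ⊗ₜ t) ⊗ₜ x)) : f = f' := by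
  refine TensorProduct.ext_threefold fun y t x => ?_
  obtain ⟨y, rfl⟩ := P.lower_surj y
  exact h y t x

theorem wt_mul (γ γ' : Γ) : P.wt (γ * γ') = P.wt γ * P.wt γ' := by
  ext j
  simp [wt, mul_comm]

theorem opG_one : P.opG 1 = 1 := by
  have h : P.wt 1 = 1 := by
    ext j
    simp [wt]
  refine P.hom_ext fun y t x => ?_
  simp [opG_tmul, h, scale_one_apply]

theorem opG_mul (γ γ' : Γ) : P.opG (γ * γ') = P.opG γ * P.opG γ' := by
  refine P.hom_ext fun y t x => ?_
  simp [opG_tmul, wt_mul, scale_scale, mul_assoc, Module.End.mul_apply]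

theorem opG_eq_one {γ : Γ} (h : P.ψ γ = 1) (h' : P.g γ = 1) : P.opG γ = 1 := by
  have hw : P.wt γ = 1 := by
    ext j
    simp [wt, h]
  refine P.hom_ext fun y t x => ?_
  simp [opG_tmul, hw, h', scale_one_apply]

theorem lift_opB_apply (f y : FreeAlgebra R I) (t : T) (x : N₂) :
    FreeAlgebra.lift R P.opB f ((P.lower y ⊗ₜ t) ⊗ₜ x) = (P.lower (f * y) ⊗ₜ t) ⊗ₜ x := by
  induction f using induction_left with
  | one => simp
  | add f f' hf hf' =>
    simp only [map_add, LinearMap.add_apply, hf, hf', add_mul, TensorProduct.add_tmul]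
  | smul a f hf =>
    simp only [map_smul, LinearMap.smul_apply, hf, smul_mul_assoc, TensorProduct.smul_tmul']
  | mul j f hf =>
    rw [map_mul, Module.End.mul_apply, hf, FreeAlgebra.lift_ι_apply, opB_tmul, mul_assoc]

/-- The operators `opB` are left multiplications on `N₁`, so the relations of `N₁` hold for them
with no stability condition; compare `lift_opA_eq_zero`. -/
theorem lift_opB_eq_zero {f : FreeAlgebra R I} (hf : P.lower f = 0) :
    FreeAlgebra.lift R P.opB f = 0 := by
  refine P.hom_ext fun y t x => ?_
  simp [lift_opB_apply, hf]

/-- Vectors are obtained from `1 ⊗ 1 ⊗ x` by the operators `g(γ)` and `B_i`. -/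
theorem tmul_eq (y : FreeAlgebra R I) (γ : Γ) (x : N₂) :
    (P.lower y ⊗ₜ[R] P.g γ) ⊗ₜ[R] x =
      FreeAlgebra.lift R P.opB y (P.opG γ ((1 ⊗ₜ 1) ⊗ₜ x)) := by
  have h := P.opG_tmul γ 1 1 x
  rw [map_one, map_one, mul_one] at h
  rw [h, lift_opB_apply, mul_one]

/-- Since `g(Γ)` spans `T`, the middle factor may be taken in `g(Γ)`; such vectors are reached from
`1 ⊗ 1 ⊗ x` by `tmul_eq`. -/
theorem mem_of_tmul_mem (S : Submodule R ((N₁ ⊗[R] T) ⊗[R] N₂))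
    (h : ∀ y γ x, (P.lower y ⊗ₜ[R] P.g γ) ⊗ₜ[R] x ∈ S) (v) : v ∈ S := by
  induction v with
  | zero => exact S.zero_mem
  | add v w hv hw => exact S.add_mem hv hw
  | tmul z x =>
    induction z with
    | zero => simp
    | add v w hv hw => rw [TensorProduct.add_tmul]; exact S.add_mem hv hw
    | tmul y t =>
      obtain ⟨y, rfl⟩ := P.lower_surj y
      have ht : t ∈ Submodule.span R (Set.range P.g) := by rw [P.span_g]; trivial
      induction ht using Submodule.span_induction with
      | mem t ht => obtain ⟨γ, rfl⟩ := ht; exact h y γ x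
      | zero => simp
      | add t t' _ _ ht ht' =>
        rw [TensorProduct.tmul_add, TensorProduct.add_tmul]; exact S.add_mem ht ht'
      | smul a t _ ht =>
        rw [TensorProduct.tmul_smul, ← TensorProduct.smul_tmul']; exact S.smul_mem a ht

/-! ### Commutation relations and straightening of words -/

variable [Fintype κ]

open Classical in
/-- Elements `A_i`, `B_i`, `G(γ)` of an algebra satisfy the commutation relations of a triangular
datum. -/
structure Rels (P : TriangularDatum R I κ Γ T N₁ N₂) {W : Type*} [Ring W] [Algebra R W]
    (A B : I → W) (G : Γ → W) : Prop where
  comm : ∀ i j, A i * B j - P.ε i j • (B j * A i) =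
    if i = j then ∑ k, P.coeff i k • G (P.elt i k) else 0
  G_lower : ∀ γ i, G γ * B i = P.wt γ i • (B i * G γ)
  G_upper : ∀ γ i, A i * G γ = P.wt γ i • (G γ * A i)

namespace Rels

variable {P : TriangularDatum R I κ Γ T N₁ N₂} {W : Type*} [Ring W] [Algebra R W]
    {A B : I → W} {G : Γ → W}

theorem G_mul_lift (h : P.Rels A B G) (γ : Γ) (x : FreeAlgebra R I) :
    G γ * FreeAlgebra.lift R B x = FreeAlgebra.lift R B (scale (P.wt γ) x) * G γ := by
  induction x using induction_left with
  | one => simp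
  | add x x' hx hx' => simp [mul_add, add_mul, hx, hx']
  | smul a x hx => simp [hx]
  | mul j x hx =>
    rw [map_mul, FreeAlgebra.lift_ι_apply, ← mul_assoc, h.G_lower, smul_mul_assoc, mul_assoc, hx]
    simp [mul_assoc]

theorem lift_mul_G (h : P.Rels A B G) (γ : Γ) (x : FreeAlgebra R I) :
    FreeAlgebra.lift R A x * G γ = G γ * FreeAlgebra.lift R A (scale (P.wt γ) x) := by
  induction x using induction_left with
  | one => simp
  | add x x' hx hx' => simp [mul_add, add_mul, hx, hx']
  | smul a x hx => simp [hx]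
  | mul j x hx =>
    rw [map_mul, FreeAlgebra.lift_ι_apply, mul_assoc, hx, ← mul_assoc, h.G_upper]
    simp [mul_assoc]

/-- `A i` travels to the right: each letter passed contributes `ε i`, and at a letter `B i` it may
be absorbed, leaving `G (elt i k)`, which then passes the remaining letters and rescales them by its
weight. This formula dictates the definition of `opA`. -/
theorem A_mul_lift (h : P.Rels A B G) (i : I) (x : FreeAlgebra R I) :
    A i * FreeAlgebra.lift R B x = FreeAlgebra.lift R B (scale (P.ε i) x) * A i +
      ∑ k, P.coeff i k • (FreeAlgebra.lift R B (skewDeriv i (P.ε i) (P.wt (P.elt i k)) x) *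
        G (P.elt i k)) := by
  induction x using induction_left with
  | one => simp
  | add x x' hx hx' =>
    simp only [map_add, mul_add, add_mul, hx, hx', smul_add, Finset.sum_add_distrib]
    abel
  | smul a x hx =>
    simp only [map_smul, mul_smul_comm, smul_mul_assoc, hx, smul_add, Finset.smul_sum]
    simp only [smul_comm a]
  | mul j x hx =>
    have hc := h.comm i j
    rw [sub_eq_iff_eq_add] at hc
    rw [map_mul, FreeAlgebra.lift_ι_apply, ← mul_assoc, hc, add_mul, smul_mul_assoc, mul_assoc, hx]
    simp only [skewDeriv_gen_mul, map_mul, scale_gen, FreeAlgebra.lift_ι_apply, map_add, map_smul,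
      smul_mul_assoc, mul_add, smul_add, add_mul, Finset.sum_add_distrib, Finset.mul_sum,
      Finset.smul_sum, mul_assoc]
    rw [add_comm, add_assoc]
    congr 1
    congr 1
    · refine Finset.sum_congr rfl fun k _ => ?_
      rw [mul_smul_comm, smul_comm]
    · by_cases hij : i = j
      · simp [hij, Finset.sum_mul, h.G_mul_lift]
      · simp [hij]

/-- The mirror image of `A_mul_lift`: `B j` travels to the left, so the letters after the removed
one carry `ε`, and those before it carry the weight of the torus element that is pulled out to the
front. -/
theorem lift_mul_B (h : P.Rels A B G) (j : I) (x : FreeAlgebra R I) :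
    FreeAlgebra.lift R A x * B j = B j * FreeAlgebra.lift R A (scale (fun i => P.ε i j) x) +
      ∑ k, P.coeff j k • (G (P.elt j k) *
        FreeAlgebra.lift R A (skewDeriv j (P.wt (P.elt j k)) (fun i => P.ε i j) x)) := by
  induction x using induction_left with
  | one => simp
  | add x x' hx hx' =>
    simp only [map_add, mul_add, add_mul, hx, hx', smul_add, Finset.sum_add_distrib]
    abel
  | smul a x hx =>
    simp only [map_smul, mul_smul_comm, smul_mul_assoc, hx, smul_add, Finset.smul_sum]
    simp only [smul_comm a]
  | mul i x hx =>
    have hc := h.comm i j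
    rw [sub_eq_iff_eq_add] at hc
    rw [map_mul, FreeAlgebra.lift_ι_apply, mul_assoc, hx, mul_add, ← mul_assoc, hc]
    simp only [skewDeriv_gen_mul, map_mul, scale_gen, FreeAlgebra.lift_ι_apply, map_add, map_smul,
      smul_mul_assoc, mul_smul_comm, mul_add, smul_add, add_mul, Finset.sum_add_distrib,
      Finset.mul_sum, mul_assoc]
    rw [add_comm (_ * _ : W), add_assoc]
    congr 1
    rw [add_comm]
    congr 1
    · refine Finset.sum_congr rfl fun k _ => ?_
      rw [← mul_assoc, h.G_upper, smul_mul_assoc, mul_assoc]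
    · by_cases hij : i = j
      · simp [hij, Finset.sum_mul]
      · simp [hij, Ne.symm hij]

end Rels

/-! ### The representation on `N₁ ⊗ T ⊗ N₂` -/

/-- The action of `A_i` on `N₁ ⊗ T ⊗ N₂`. -/
def opA (i : I) : Module.End R ((N₁ ⊗[R] T) ⊗[R] N₂) :=
  TensorProduct.map (TensorProduct.map (P.scaleLower (P.ε i)) (P.s i).toLinearMap)
    (LinearMap.mulLeft R (P.upper (θ i))) +
  ∑ k, P.coeff i k • TensorProduct.map (TensorProduct.map (P.derivLower i k)
    (LinearMap.mulLeft R (P.g (P.elt i k)))) LinearMap.id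

theorem opA_tmul (i : I) (y : FreeAlgebra R I) (t : T) (x : N₂) :
    P.opA i ((P.lower y ⊗ₜ t) ⊗ₜ x) =
      (P.lower (scale (P.ε i) y) ⊗ₜ P.s i t) ⊗ₜ (P.upper (θ i) * x) +
      ∑ k, P.coeff i k • ((P.lower (skewDeriv i (P.ε i) (P.wt (P.elt i k)) y) ⊗ₜ
        (P.g (P.elt i k) * t)) ⊗ₜ[R] x) := by
  simp [opA, scaleLower_apply, derivLower_apply, LinearMap.sum_apply]

/-- The relation between `opA` and `opB` is the recursion `skewDeriv_gen_mul`: its inhomogeneous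
term, the tail rescaled by the weight of `elt i k`, is the action of `opG (elt i k)`. -/
theorem rels_op : P.Rels P.opA P.opB P.opG where
  comm i j := by
    refine P.hom_ext fun y t x => ?_
    rw [LinearMap.sub_apply, Module.End.mul_apply, opB_tmul, opA_tmul, LinearMap.smul_apply,
      Module.End.mul_apply, opA_tmul, map_add, opB_tmul, map_sum]
    simp only [map_smul, opB_tmul, skewDeriv_gen_mul, map_mul, scale_gen, map_add,
      TensorProduct.add_tmul, smul_add, Finset.sum_add_distrib, Finset.smul_sum,
      smul_mul_assoc, ← TensorProduct.smul_tmul', smul_comm (P.ε i j)]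
    by_cases hij : i = j
    · subst hij
      simp only [if_true, LinearMap.sum_apply, LinearMap.smul_apply, opG_tmul]
      abel
    · simp [hij]
  G_lower γ i := by
    refine P.hom_ext fun y t x => ?_
    rw [Module.End.mul_apply, opB_tmul, opG_tmul, LinearMap.smul_apply, Module.End.mul_apply,
      opG_tmul, opB_tmul, map_mul, scale_gen, smul_mul_assoc, map_smul, TensorProduct.smul_tmul',
      TensorProduct.smul_tmul']
  G_upper γ i := by
    refine P.hom_ext fun y t x => ?_
    simp only [LinearMap.smul_apply, Module.End.mul_apply, opA_tmul, opG_tmul, map_add, map_sum,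
      map_smul, map_mul, s_g, smul_add, Finset.smul_sum, scale_scale, skewDeriv_scale,
      smul_mul_assoc, ← TensorProduct.smul_tmul', TensorProduct.tmul_smul]
    -- Both parts of `opA` acquire the scalar `wt γ i`: the first from `s_g`, the sum from
    -- `skewDeriv_scale`. In the sum, commutativity of `Γ` then exchanges `g γ` and `g (elt i k)`.
    congr 1
    · rw [mul_comm (P.ε i)]
      rfl
    · refine Finset.sum_congr rfl fun k _ => ?_
      rw [smul_comm, ← mul_assoc, ← mul_assoc, ← map_mul, ← map_mul, mul_comm γ]

/-- On the empty lower word the skew derivation vanishes, so only the first term of `opA` survives.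
-/
theorem lift_opA_one (f : FreeAlgebra R I) (x : N₂) :
    FreeAlgebra.lift R P.opA f ((1 ⊗ₜ 1) ⊗ₜ x) = (1 ⊗ₜ 1) ⊗ₜ (P.upper f * x) := by
  induction f using induction_left with
  | one => simp
  | add f f' hf hf' =>
    simp only [map_add, LinearMap.add_apply, hf, hf', add_mul, TensorProduct.tmul_add]
  | smul a f hf =>
    simp only [map_smul, LinearMap.smul_apply, hf, smul_mul_assoc, TensorProduct.tmul_smul]
  | mul j f hf =>
    have h := P.opA_tmul j 1 1 (P.upper f * x)
    simp only [map_one, skewDeriv_one, map_zero, TensorProduct.zero_tmul, smul_zero,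
      Finset.sum_const_zero, add_zero] at h
    rw [map_mul, Module.End.mul_apply, hf, FreeAlgebra.lift_ι_apply, h, map_mul, mul_assoc]

/-- Vectors `1 ⊗ 1 ⊗ x` are killed by `lift_opA_one`, and all others are reached from them by `opG`
and `opB`. Moving the word `f` past these operators replaces it by its rescalings and skew
derivatives, which again lie in the kernel of `upper`. -/
theorem lift_opA_eq_zero {f : FreeAlgebra R I} (hf : P.upper f = 0) :
    FreeAlgebra.lift R P.opA f = 0 := by
  -- The condition ranges over the whole kernel, since the induction passes from `f` to other
  -- elements of it.
  let S : Submodule R ((N₁ ⊗[R] T) ⊗[R] N₂) :=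
    { carrier := {v | ∀ f, P.upper f = 0 → FreeAlgebra.lift R P.opA f v = 0}
      zero_mem' := by simp
      add_mem' := fun hv hw f hf => by rw [map_add, hv f hf, hw f hf, add_zero]
      smul_mem' := fun a v hv f hf => by rw [map_smul, hv f hf, smul_zero] }
  have hS : ∀ v, v ∈ S := by
    refine P.mem_of_tmul_mem S fun y γ x => ?_
    rw [tmul_eq]
    have hB : ∀ v ∈ S, FreeAlgebra.lift R P.opB y v ∈ S := by
      induction y using induction_left with
      | one => intro v hv; simpa using hv
      | add y y' hy hy' =>
        intro v hv
        rw [map_add, LinearMap.add_apply]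
        exact S.add_mem (hy v hv) (hy' v hv)
      | smul a y hy =>
        intro v hv
        rw [map_smul, LinearMap.smul_apply]
        exact S.smul_mem a (hy v hv)
      | mul j y hy =>
        intro v hv f hf
        have hv' := hy v hv
        rw [map_mul, Module.End.mul_apply, FreeAlgebra.lift_ι_apply, ← Module.End.mul_apply,
          P.rels_op.lift_mul_B, LinearMap.add_apply, Module.End.mul_apply,
          hv' _ (P.scale_upper _ _ hf), map_zero, zero_add, LinearMap.sum_apply]
        refine Finset.sum_eq_zero fun k _ => ?_
        have h0 : P.upper (skewDeriv j (P.wt (P.elt j k)) (fun i => P.ε i j) f) = 0 :=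
          P.deriv_upper j k f hf
        rw [LinearMap.smul_apply, Module.End.mul_apply, hv' _ h0, map_zero, smul_zero]
    refine hB _ fun f hf => ?_
    rw [← Module.End.mul_apply, P.rels_op.lift_mul_G, Module.End.mul_apply, lift_opA_one,
      P.scale_upper _ _ hf]
    simp
  ext1
  ext1
  ext v
  exact hS _ f hf

/-- The triangular decomposition: an algebra that is generated by `A_i`, `B_i`, `g(γ)` subject to
the relations of the datum, and that acts on `N₁ ⊗ T ⊗ N₂`, is isomorphic to `N₁ ⊗ T ⊗ N₂`. -/
theorem bijective_tripleMul {U : Type*} [Ring U] [Algebra R U]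
    (a : N₁ →ₐ[R] U) (b : T →ₐ[R] U) (c : N₂ →ₐ[R] U)
    (hrels : P.Rels (fun i => c (P.upper (θ i))) (fun i => a (P.lower (θ i)))
      (fun γ => b (P.g γ)))
    (ρ : U →ₐ[R] Module.End R ((N₁ ⊗[R] T) ⊗[R] N₂))
    (hA : ∀ i, ρ (c (P.upper (θ i))) = P.opA i) (hB : ∀ i, ρ (a (P.lower (θ i))) = P.opB i)
    (hG : ∀ γ, ρ (b (P.g γ)) = P.opG γ)
    (hgen : Algebra.adjoin R (Set.range (fun i => c (P.upper (θ i))) ∪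
      Set.range (fun i => a (P.lower (θ i))) ∪ Set.range (fun γ => b (P.g γ))) = ⊤) :
    Function.Bijective (tripleMul a b c) := by
  have ha : ∀ y, a (P.lower y) = FreeAlgebra.lift R (fun i => a (P.lower (θ i))) y := by
    intro y
    have h : a.comp P.lower = FreeAlgebra.lift R (fun i => a (P.lower (θ i))) := by ext i; simp
    exact AlgHom.congr_fun h y
  have hφ : ∀ y t x, tripleMul a b c ((y ⊗ₜ t) ⊗ₜ x) = a y * b t * c x := by
    intro y t x
    simp [tripleMul]
  -- Acting on `1 ⊗ 1 ⊗ 1` is a left inverse of the multiplication map.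
  have hρ : ∀ v, ρ (tripleMul a b c v) ((1 ⊗ₜ 1) ⊗ₜ 1) = v := by
    intro v
    refine P.mem_of_tmul_mem (LinearMap.eqLocus
      ((LinearMap.applyₗ ((1 ⊗ₜ 1) ⊗ₜ 1)).comp (ρ.toLinearMap.comp (tripleMul a b c)))
      LinearMap.id) (fun y γ x => ?_) v
    obtain ⟨x, rfl⟩ := P.upper_surj x
    have h1 : ρ (a (P.lower y)) = FreeAlgebra.lift R P.opB y := by
      have h : (ρ.comp a).comp P.lower = FreeAlgebra.lift R P.opB := by ext1; ext1 i; simp [hB]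
      exact AlgHom.congr_fun h y
    have h2 : ρ (c (P.upper x)) = FreeAlgebra.lift R P.opA x := by
      have h : (ρ.comp c).comp P.upper = FreeAlgebra.lift R P.opA := by ext1; ext1 i; simp [hA]
      exact AlgHom.congr_fun h x
    simp only [LinearMap.mem_eqLocus, LinearMap.comp_apply, hφ, AlgHom.toLinearMap_apply,
      map_mul, h1, h2, hG, LinearMap.applyₗ_apply_apply, Module.End.mul_apply, LinearMap.id_apply,
      lift_opA_one, mul_one]
    rw [tmul_eq]
  -- The multiplication map intertwines `ρ` with the left regular representation; it suffices to
  -- check this on generators.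
  have hint : ∀ u v, tripleMul a b c (ρ u v) = u * tripleMul a b c v := by
    intro u
    have hu : u ∈ Algebra.adjoin R (Set.range (fun i => c (P.upper (θ i))) ∪
      Set.range (fun i => a (P.lower (θ i))) ∪ Set.range (fun γ => b (P.g γ))) := by
      rw [hgen]; trivial
    induction hu using Algebra.adjoin_induction with
    | algebraMap r =>
      intro v
      rw [AlgHom.commutes, Module.algebraMap_end_apply, map_smul, Algebra.smul_def]
    | add u u' _ _ hu hu' =>
      intro v
      rw [map_add, LinearMap.add_apply, map_add, hu, hu', add_mul]
    | mul u u' _ _ hu hu' =>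
      intro v
      rw [map_mul, Module.End.mul_apply, hu, hu', mul_assoc]
    | mem u hu =>
      rcases hu with (⟨i, rfl⟩ | ⟨i, rfl⟩) | ⟨γ, rfl⟩
      -- On `g(Γ)` this is the relation `G_upper`, and `s i` extends it linearly to `T`.
      · have hs : ∀ t, c (P.upper (θ i)) * b t = b (P.s i t) * c (P.upper (θ i)) := by
          intro t
          have ht : t ∈ Submodule.span R (Set.range P.g) := by rw [P.span_g]; trivial
          induction ht using Submodule.span_induction with
          | mem t ht =>
            obtain ⟨γ, rfl⟩ := ht
            rw [hrels.G_upper, P.s_g, map_smul, smul_mul_assoc]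
            rfl
          | zero => simp
          | add t t' _ _ ht ht' => simp only [map_add, mul_add, add_mul, ht, ht']
          | smul r t _ ht => simp only [map_smul, mul_smul_comm, smul_mul_assoc, ht]
        have h : (tripleMul a b c).comp (P.opA i) =
            (LinearMap.mulLeft R (c (P.upper (θ i)))).comp (tripleMul a b c) := by
          refine P.hom_ext fun y t x => ?_
          simp only [LinearMap.comp_apply, opA_tmul, map_add, map_sum, map_smul, hφ, map_mul,
            LinearMap.mulLeft_apply]
          -- The straightening formula in `U` matches `opA` term by term.
          have hcomm := hrels.A_mul_lift i y
          simp only [← ha] at hcomm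
          rw [← mul_assoc, ← mul_assoc, ← mul_assoc, hcomm]
          simp only [add_mul, Finset.sum_mul, smul_mul_assoc, mul_assoc]
          rw [← mul_assoc (c _) (b t), hs, mul_assoc]
        intro v
        rw [hA]
        exact LinearMap.congr_fun h v
      · have h : (tripleMul a b c).comp (P.opB i) =
            (LinearMap.mulLeft R (a (P.lower (θ i)))).comp (tripleMul a b c) := by
          refine P.hom_ext fun y t x => ?_
          simp only [LinearMap.comp_apply, opB_tmul, hφ, map_mul, LinearMap.mulLeft_apply,
            mul_assoc]
        intro v
        rw [hB]
        exact LinearMap.congr_fun h v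
      · have h : (tripleMul a b c).comp (P.opG γ) =
            (LinearMap.mulLeft R (b (P.g γ))).comp (tripleMul a b c) := by
          refine P.hom_ext fun y t x => ?_
          simp only [LinearMap.comp_apply, opG_tmul, hφ, map_mul, LinearMap.mulLeft_apply]
          rw [← mul_assoc, ← mul_assoc, ← mul_assoc, ha y, hrels.G_mul_lift, ha]
        intro v
        rw [hG]
        exact LinearMap.congr_fun h v
  -- The preimage of `u` is found by applying the intertwining property to the vector `1 ⊗ 1 ⊗ 1`,
  -- whose product is `1`.
  refine ⟨fun v v' h => ?_, fun u => ⟨ρ u ((1 ⊗ₜ 1) ⊗ₜ 1), ?_⟩⟩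
  · rw [← hρ v, ← hρ v', h]
  · rw [hint, hφ]
    simp

end TriangularDatum

/-! ## The radical is stable under rescalings and skew derivations -/

section FormAdjoint

variable {R : Type*} [CommRing R] {I : Type*} (χ : I → I → R) (c : I → R)

theorem derivLeft_eq_skewDeriv (i : I) (x : FreeAlgebra R I) :
    derivLeft χ i x = skewDeriv i (fun j => χ j i) 1 x := by
  induction x using induction_left with
  | one => simp [derivLeft, coeffGen]
  | add x x' hx hx' => simp [hx, hx']
  | smul a x hx => simp [hx]
  | mul j x hx =>
    rw [derivLeft_gen_mul, skewDeriv_gen_mul, hx, scale_one_apply, add_comm]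

theorem form_one_right (x : FreeAlgebra R I) : form χ c x 1 = augmentation x := by
  simp [form_apply, toDual_one]

theorem form_gen_mul_right (i : I) (x y : FreeAlgebra R I) :
    form χ c x (θ i * y) = c i * form χ c (skewDeriv i (fun j => χ j i) 1 x) y := by
  rw [form_apply, toDual_gen_mul, LinearMap.smul_apply, conv_coeffGen, derivLeft_eq_skewDeriv,
    form_apply, smul_eq_mul]

theorem augmentation_scale (φ : I → R) (x : FreeAlgebra R I) :
    augmentation (scale φ x) = augmentation (R := R) x := by
  have h : (augmentation (R := R)).comp (scale φ) = augmentation := by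
    ext k
    simp [augmentation]
  exact AlgHom.congr_fun h x

/-- Peeling a letter `θ j` off `y` yields `φ j` on the right, and `skewDeriv_scale` yields the same
factor on the left. -/
theorem form_scale (φ : I → R) (x y : FreeAlgebra R I) :
    form χ c (scale φ x) y = form χ c x (scale φ y) := by
  induction y using induction_left generalizing x with
  | one => simp only [map_one, form_one_right, augmentation_scale]
  | add y y' hy hy' => simp [hy, hy']
  | smul a y hy => simp [hy]
  | mul j y hy =>
    rw [form_gen_mul_right, skewDeriv_scale, map_mul, scale_gen, smul_mul_assoc, map_smul, map_smul,
      form_gen_mul_right, LinearMap.smul_apply, hy, smul_eq_mul, smul_eq_mul, mul_left_comm]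

/-- Either order removes one `θ_i` and one `θ_k`. If the `θ_i` stands before the `θ_k`, each order
picks up `χ i k` exactly once, from whichever letter is still present; otherwise neither picks up
such a factor. No symmetry of `χ` is needed. -/
theorem skewDeriv_comm (i k : I) (x : FreeAlgebra R I) :
    skewDeriv i 1 (χ i) (skewDeriv k (fun j => χ j k) 1 x) =
      skewDeriv k (fun j => χ j k) 1 (skewDeriv i 1 (χ i) x) := by
  induction x using induction_left with
  | one => simp
  | add x x' hx hx' => simp [hx, hx']
  | smul a x hx => simp [hx]
  | mul j x hx =>
    by_cases hij : i = j
    · subst hij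
      by_cases hki : k = i
      · subst hki
        simp [skewDeriv_gen_mul, hx, scale_one_apply, skewDeriv_scale, add_comm, add_left_comm]
      · simp [skewDeriv_gen_mul, hx, hki, skewDeriv_scale]
    · by_cases hkj : k = j
      · subst hkj
        simp [skewDeriv_gen_mul, hx, hij, scale_one_apply]
      · simp [skewDeriv_gen_mul, hx, hij, hkj]

/-- Letters are peeled off the left end of `y`, which is harmless because the two kinds of skew
derivation commute. -/
theorem form_mul_gen_right (i : I) (x y : FreeAlgebra R I) :
    form χ c x (y * θ i) = c i * form χ c (skewDeriv i 1 (χ i) x) y := by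
  induction y using induction_left generalizing x with
  | one =>
    rw [one_mul, ← mul_one (θ i), form_gen_mul_right, form_one_right, form_one_right]
    congr 1
    -- Both skew derivatives of `x` have the same constant term, namely the coefficient of `θ_i` in
    -- `x`.
    induction x using induction_left with
    | one => simp
    | add x x' hx hx' => simp [hx, hx']
    | smul a x hx => simp [hx]
    | mul j x hx =>
      have h0 : augmentation (R := R) (θ j) = 0 := by simp [augmentation]
      by_cases hij : i = j <;> simp [skewDeriv_gen_mul, h0, augmentation_scale, hij, scale_one_apply]
  | add y y' hy hy' => simp [add_mul, mul_add, hy, hy']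
  | smul a y hy => simp [hy, mul_left_comm]
  | mul k y hy =>
    rw [mul_assoc, form_gen_mul_right, hy, form_gen_mul_right, skewDeriv_comm, mul_left_comm]

end FormAdjoint

section Radical

variable {I : Type u} [Fintype I] (C : SuperCartanDatum I)

theorem isUnit_form_coeff (i : I) :
    IsUnit (Ring.inverse (1 - ((C.pii i * C.qi i ^ (-2 : ℤ) : Qqpiˣ) : Qqpi))) :=
  (isUnit_one_sub C i).ringInverse

theorem scale_mem_radical (φ : I → Qqpi) {x : FreeHalf I} (hx : x ∈ radical C) :
    scale φ x ∈ radical C := fun y => by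
  rw [halfForm, form_scale]
  exact hx _

/-- For `φ = 1` this is the adjoint of left multiplication by `θ i`, whose constant is invertible
and can be cancelled; a rescaling gives general `φ`. -/
theorem skewDeriv_mem_radical (i : I) (φ : I → Qqpi) {x : FreeHalf I} (hx : x ∈ radical C) :
    skewDeriv i (φ * C.chi i) φ x ∈ radical C := by
  have h : skewDeriv i (fun j => C.chi j i) 1 x ∈ radical C := fun y => by
    have h := hx (θ i * y)
    rw [halfForm, form_gen_mul_right] at h
    exact (isUnit_form_coeff C i).mul_right_eq_zero.mp h
  have h' := scale_mem_radical C φ h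
  rw [scale_skewDeriv, mul_one] at h'
  simpa only [C.chi_comm _ i] using h'

/-- The same argument with right multiplication by `θ i`, which puts `χ` on the letters after the
removed one. -/
theorem skewDeriv_mem_radical' (i : I) (φ : I → Qqpi) {x : FreeHalf I} (hx : x ∈ radical C) :
    skewDeriv i φ (φ * C.chi i) x ∈ radical C := by
  have h : skewDeriv i 1 (C.chi i) x ∈ radical C := fun y => by
    have h := hx (y * θ i)
    rw [halfForm, form_mul_gen_right] at h
    exact (isUnit_form_coeff C i).mul_right_eq_zero.mp h
  have h' := scale_mem_radical C φ h
  rwa [scale_skewDeriv, mul_one] at h'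

/-- The counit of `f`. -/
def halfCounit : Half C →ₐ[Qqpi] Qqpi :=
  Ideal.Quotient.liftₐ (radical C) augmentation fun x hx => by
    -- The augmentation is the pairing with `1`, so it vanishes on the radical.
    rw [← form_one_right C.chi]
    exact hx 1

end Radical

/-! ## The torus part `U⁰` -/

/-- An algebra presented by generators is generated by them. -/
theorem eq_top_of_gen_mem {R Z : Type*} [CommRing R] {W : Type*} [Ring W] [Algebra R W]
    (mk : FreeAlgebra R Z →ₐ[R] W) (hmk : Function.Surjective mk) (S : Subalgebra R W)
    (h : ∀ z, mk (FreeAlgebra.ι R z) ∈ S) : S = ⊤ := by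
  rw [eq_top_iff]
  intro u _
  obtain ⟨x, rfl⟩ := hmk u
  induction x using FreeAlgebra.induction with
  | grade0 r => rw [AlgHom.commutes]; exact S.algebraMap_mem r
  | grade1 z => exact h z
  | mul x y hx hy => rw [map_mul]; exact S.mul_mem (hx trivial) (hy trivial)
  | add x y hx hy => rw [map_add]; exact S.add_mem (hx trivial) (hy trivial)

namespace UZero

variable {Y : Type v} [AddCommGroup Y]

theorem K_zero : K (0 : Y) = 1 := by
  rw [K, RingQuot.mkAlgHom_rel Qqpi ZeroRel.K_zero, map_one]

theorem K_mul (μ ν : Y) : K μ * K ν = K (μ + ν) := by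
  rw [K, K, ← map_mul, RingQuot.mkAlgHom_rel Qqpi (ZeroRel.K_add μ ν), K]

theorem J_two (μ : Y) : J (2 • μ) = 1 := by
  rw [J, RingQuot.mkAlgHom_rel Qqpi (ZeroRel.J_two μ), map_one]

theorem J_zero : J (0 : Y) = 1 := by
  rw [← smul_zero 2, J_two]

theorem J_mul (μ ν : Y) : J μ * J ν = J (μ + ν) := by
  rw [J, J, ← map_mul, RingQuot.mkAlgHom_rel Qqpi (ZeroRel.J_add μ ν), J]

theorem J_mul_K (μ ν : Y) : J μ * K ν = K ν * J μ := by
  rw [J, K, ← map_mul, RingQuot.mkAlgHom_rel Qqpi (ZeroRel.J_K μ ν), map_mul]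

/-- The elements `J_ν K_μ`. -/
def grouplike : Multiplicative (Y × Y) →* UZero Y where
  toFun γ := J γ.toAdd.2 * K γ.toAdd.1
  map_one' := by simp [K_zero, J_zero]
  map_mul' γ γ' := by
    simp only [toAdd_mul, Prod.snd_add, Prod.fst_add, ← J_mul, ← K_mul]
    rw [mul_assoc, ← mul_assoc (J _) (K _), J_mul_K]
    simp only [mul_assoc]

theorem grouplike_K (μ : Y) : grouplike (Multiplicative.ofAdd (μ, 0)) = K μ := by
  simp [grouplike, J_zero]

theorem grouplike_J (μ : Y) : grouplike (Multiplicative.ofAdd (0, μ)) = J μ := by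
  simp [grouplike, K_zero]

theorem grouplike_two (μ : Y) : grouplike (Multiplicative.ofAdd (0, 2 • μ)) = 1 := by
  rw [grouplike_J, J_two]

/-- The range is a submonoid containing all `J_μ` and `K_μ`, so its span is already the subalgebra
it generates. -/
theorem span_grouplike : Submodule.span Qqpi (Set.range (grouplike (Y := Y))) = ⊤ := by
  have h : Algebra.adjoin Qqpi (Set.range (grouplike (Y := Y))) = ⊤ := by
    refine eq_top_of_gen_mem _ (RingQuot.mkAlgHom_surjective Qqpi (ZeroRel Y)) _ fun z => ?_
    cases z with
    | J μ => exact Algebra.subset_adjoin ⟨_, grouplike_J μ⟩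
    | K μ => exact Algebra.subset_adjoin ⟨_, grouplike_K μ⟩
  rw [← MonoidHom.coe_mrange, ← Algebra.top_toSubmodule, ← h, Algebra.adjoin_eq_span,
    ← MonoidHom.coe_mrange, Submonoid.closure_eq]

/-- An algebra map out of `U⁰` is given by a monoid homomorphism from `Y × Y`. -/
def lift {W : Type*} [Ring W] [Algebra Qqpi W] (G : Multiplicative (Y × Y) →* W)
    (hG : ∀ ν, G (Multiplicative.ofAdd (0, 2 • ν)) = 1) : UZero Y →ₐ[Qqpi] W :=
  RingQuot.liftAlgHom Qqpi
    ⟨FreeAlgebra.lift Qqpi fun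
      | Gen0.J μ => G (Multiplicative.ofAdd (0, μ))
      | Gen0.K μ => G (Multiplicative.ofAdd (μ, 0)), fun _ _ h => by
        cases h with
        | K_zero =>
          rw [FreeAlgebra.lift_ι_apply, map_one]
          exact G.map_one
        | K_add μ ν =>
          simp only [map_mul, FreeAlgebra.lift_ι_apply]
          rw [← map_mul, ← ofAdd_add, Prod.mk_add_mk, add_zero]
        | J_two μ => simpa only [FreeAlgebra.lift_ι_apply, map_one] using hG μ
        | J_add μ ν =>
          simp only [map_mul, FreeAlgebra.lift_ι_apply]
          rw [← map_mul, ← ofAdd_add, Prod.mk_add_mk, add_zero]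
        | J_K μ ν =>
          simp only [map_mul, FreeAlgebra.lift_ι_apply]
          rw [← map_mul, mul_comm, map_mul]⟩

theorem lift_K {W : Type*} [Ring W] [Algebra Qqpi W] (G : Multiplicative (Y × Y) →* W) (hG)
    (μ : Y) : lift G hG (K μ) = G (Multiplicative.ofAdd (μ, 0)) := by
  simp [lift, K, RingQuot.liftAlgHom_mkAlgHom_apply]

theorem lift_J {W : Type*} [Ring W] [Algebra Qqpi W] (G : Multiplicative (Y × Y) →* W) (hG)
    (μ : Y) : lift G hG (J μ) = G (Multiplicative.ofAdd (0, μ)) := by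
  simp [lift, J, RingQuot.liftAlgHom_mkAlgHom_apply]

theorem lift_grouplike {W : Type*} [Ring W] [Algebra Qqpi W] (G : Multiplicative (Y × Y) →* W) (hG)
    (γ : Multiplicative (Y × Y)) : lift G hG (grouplike γ) = G γ := by
  have h : lift G hG (grouplike γ) = lift G hG (J γ.toAdd.2) * lift G hG (K γ.toAdd.1) :=
    map_mul _ _ _
  rw [h, lift_J, lift_K, ← map_mul, ← ofAdd_add]
  simp

/-- Algebra maps out of `U⁰` are determined by the images of `J_μ` and `K_μ`. -/
theorem hom_ext {W : Type*} [Ring W] [Algebra Qqpi W] {f f' : UZero Y →ₐ[Qqpi] W}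
    (hJ : ∀ μ, f (J μ) = f' (J μ)) (hK : ∀ μ, f (K μ) = f' (K μ)) : f = f' := by
  refine RingQuot.ringQuot_ext' _ _ _ ?_
  ext z
  cases z with
  | J μ => exact hJ μ
  | K μ => exact hK μ

/-- The counit of `U⁰`. -/
def counit : UZero Y →ₐ[Qqpi] Qqpi := lift 1 fun _ => rfl

/-- `ν ↦ J_ν` on `Y/2Y`. -/
def JQuot : Y ⧸ twoMul Y →+ Additive (UZero Y) :=
  QuotientAddGroup.lift (twoMul Y)
    { toFun := fun ν => Additive.ofMul (J ν)
      map_zero' := congrArg Additive.ofMul J_zero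
      map_add' := fun μ ν => congrArg Additive.ofMul (J_mul μ ν).symm }
    (by rintro _ ⟨ν, rfl⟩; exact congrArg Additive.ofMul (J_two ν))

/-- The map from the group algebra of `Y × Y/2Y`. -/
def ofGroupAlgebra : AddMonoidAlgebra Qqpi (Y × (Y ⧸ twoMul Y)) →ₐ[Qqpi] UZero Y :=
  AddMonoidAlgebra.lift Qqpi (UZero Y) (Y × (Y ⧸ twoMul Y))
    { toFun := fun γ => (JQuot γ.toAdd.2).toMul * K γ.toAdd.1
      -- On representatives of `Y/2Y` this function is `grouplike` by definition, so the monoid laws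
      -- are inherited from there.
      map_one' := (grouplike (Y := Y)).map_one
      map_mul' := by
        intro γ γ'
        obtain ⟨μ, ν⟩ := γ
        obtain ⟨μ', ν'⟩ := γ'
        induction ν using QuotientAddGroup.induction_on with | H ν => ?_
        induction ν' using QuotientAddGroup.induction_on with | H ν' => ?_
        exact grouplike.map_mul (Multiplicative.ofAdd (μ, ν)) (Multiplicative.ofAdd (μ', ν')) }

theorem ofGroupAlgebra_single (μ ν : Y) :
    ofGroupAlgebra (AddMonoidAlgebra.single (μ, (QuotientAddGroup.mk ν : Y ⧸ twoMul Y)) 1) =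
      grouplike (Multiplicative.ofAdd (μ, ν)) := by
  rw [ofGroupAlgebra, AddMonoidAlgebra.lift_single, one_smul]
  rfl

/-- The map to the group algebra of `Y × Y/2Y`. -/
def toGroupAlgebra : UZero Y →ₐ[Qqpi] AddMonoidAlgebra Qqpi (Y × (Y ⧸ twoMul Y)) :=
  lift ((AddMonoidAlgebra.of Qqpi (Y × (Y ⧸ twoMul Y))).comp
      (AddMonoidHom.toMultiplicative
        ((AddMonoidHom.id Y).prodMap (QuotientAddGroup.mk' (twoMul Y))))) fun ν => by
    have h : (QuotientAddGroup.mk (2 • ν) : Y ⧸ twoMul Y) = 0 :=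
      (QuotientAddGroup.eq_zero_iff _).mpr ⟨ν, rfl⟩
    rw [MonoidHom.comp_apply]
    have h' : (AddMonoidHom.toMultiplicative
        ((AddMonoidHom.id Y).prodMap (QuotientAddGroup.mk' (twoMul Y))))
          (Multiplicative.ofAdd (0, 2 • ν)) = 1 :=
      congrArg (fun z => Multiplicative.ofAdd ((0 : Y), z)) h
    rw [h', map_one]

theorem toGroupAlgebra_K (μ : Y) :
    toGroupAlgebra (K μ) = AddMonoidAlgebra.single (μ, 0) 1 :=
  lift_K _ _ _

theorem toGroupAlgebra_J (ν : Y) : toGroupAlgebra (J ν) =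
    AddMonoidAlgebra.single (0, (QuotientAddGroup.mk ν : Y ⧸ twoMul Y)) 1 :=
  lift_J _ _ _

/-- `U⁰` is the group algebra of `Y × Y/2Y`. -/
def equivGroupAlgebra : UZero Y ≃ₐ[Qqpi] AddMonoidAlgebra Qqpi (Y × (Y ⧸ twoMul Y)) :=
  AlgEquiv.ofAlgHom toGroupAlgebra ofGroupAlgebra
    (by
      refine (AddMonoidAlgebra.lift Qqpi _ _).symm.injective (MonoidHom.ext fun γ => ?_)
      obtain ⟨μ, ν⟩ := γ
      induction ν using QuotientAddGroup.induction_on with | H ν => ?_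
      change toGroupAlgebra (ofGroupAlgebra (AddMonoidAlgebra.single
        (μ, (QuotientAddGroup.mk ν : Y ⧸ twoMul Y)) 1)) = _
      rw [ofGroupAlgebra_single]
      exact lift_grouplike _ _ (Multiplicative.ofAdd (μ, ν)))
    (hom_ext
      (fun μ => by
        rw [AlgHom.comp_apply, toGroupAlgebra_J, ofGroupAlgebra_single, grouplike_J]; rfl)
      (fun μ => by
        rw [AlgHom.comp_apply, toGroupAlgebra_K]
        exact (ofGroupAlgebra_single μ 0).trans (grouplike_K μ)))

end UZero

/-- The endomorphisms of a triple tensor product. -/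
abbrev TripleEnd (R A B A' : Type*) [CommRing R] [Ring A] [Ring B] [Ring A'] [Algebra R A]
    [Algebra R B] [Algebra R A'] : Type _ :=
  Module.End R ((A ⊗[R] B) ⊗[R] A')

/-! ### Maps out of the free algebra on the `E_i`, `F_i`, `J_μ`, `K_μ` -/

section GenMap

variable {I : Type u} {Y : Type v} [AddCommGroup Y] {W : Type*} [Ring W] [Algebra Qqpi W]
  (e f : I → W) (G : Multiplicative (Y × Y) →* W)

/-- The map from the free algebra on all generators given by `e_i`, `f_i` and `G`. -/
def genMap : FreeU I Y →ₐ[Qqpi] W :=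
  FreeAlgebra.lift Qqpi fun
    | Gen.E i => e i
    | Gen.F i => f i
    | Gen.J μ => G (Multiplicative.ofAdd (0, μ))
    | Gen.K μ => G (Multiplicative.ofAdd (μ, 0))

theorem genMap_E (i : I) : genMap e f G (FreeU.E Y i) = e i := by simp [genMap, FreeU.E]

theorem genMap_F (i : I) : genMap e f G (FreeU.F Y i) = f i := by simp [genMap, FreeU.F]

theorem genMap_J (μ : Y) : genMap e f G (FreeU.J I μ) = G (Multiplicative.ofAdd (0, μ)) := by
  simp [genMap, FreeU.J]

theorem genMap_K (μ : Y) : genMap e f G (FreeU.K I μ) = G (Multiplicative.ofAdd (μ, 0)) := by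
  simp [genMap, FreeU.K]

theorem genMap_lift_E (x : FreeAlgebra Qqpi I) :
    genMap e f G (FreeAlgebra.lift Qqpi (FreeU.E Y) x) = FreeAlgebra.lift Qqpi e x := by
  have h : (genMap e f G).comp (FreeAlgebra.lift Qqpi (FreeU.E Y)) = FreeAlgebra.lift Qqpi e := by
    ext i
    simp [genMap_E]
  exact AlgHom.congr_fun h x

theorem genMap_lift_F (x : FreeAlgebra Qqpi I) :
    genMap e f G (FreeAlgebra.lift Qqpi (FreeU.F Y) x) = FreeAlgebra.lift Qqpi f x := by
  have h : (genMap e f G).comp (FreeAlgebra.lift Qqpi (FreeU.F Y)) = FreeAlgebra.lift Qqpi f := by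
    ext i
    simp [genMap_F]
  exact AlgHom.congr_fun h x

end GenMap

section Concrete

variable {I : Type u} [Fintype I] {C : SuperCartanDatum I} {Y : Type v} {X : Type w}
  [AddCommGroup Y] [AddCommGroup X]

/-! ## The commutation relations of `'U` -/

/-- The factor `q ^ ⟨μ, i'⟩ π ^ ⟨ν, i'⟩` by which `J_ν K_μ` commutes with `E_i`. -/
def character (D : SuperRootDatum C Y X) : Multiplicative (Y × Y) →* (I → Qqpiˣ) where
  toFun γ i := q ^ D.pairing γ.toAdd.1 (D.root i) * pi ^ D.pairing γ.toAdd.2 (D.root i)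
  map_one' := by ext; simp
  map_mul' γ γ' := by
    funext i
    simp only [toAdd_mul, Prod.fst_add, Prod.snd_add, map_add, LinearMap.add_apply, zpow_add,
      Pi.mul_apply]
    exact mul_mul_mul_comm _ _ _ _

theorem pi_zpow_even (n : ℤ) (hn : Even n) : pi ^ n = 1 := by
  obtain ⟨m, rfl⟩ := hn
  rw [← two_mul, zpow_mul, zpow_ofNat, pi_sq, one_zpow]

theorem character_two (D : SuperRootDatum C Y X) (ν : Y) :
    character D (Multiplicative.ofAdd (0, 2 • ν)) = 1 := by
  funext i
  simp [character, pi_zpow_even]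

/-- The parity factor `π ^ (p(i) p(j))`. -/
def parityFactor (C : SuperCartanDatum I) (i j : I) : Qqpi :=
  ((pi ^ ((C.p i : ℕ) * (C.p j : ℕ)) : Qqpiˣ) : Qqpi)

theorem parityFactor_comm (i j : I) : parityFactor C i j = parityFactor C j i := by
  rw [parityFactor, parityFactor, mul_comm (C.p i : ℕ)]

theorem parityFactor_mul_self (i j : I) : parityFactor C i j * parityFactor C i j = 1 := by
  rw [parityFactor, ← Units.val_mul, ← sq, ← pow_mul, mul_comm, pow_mul, pi_sq, one_pow,
    Units.val_one]

/-- The elements `J_{d_i i} K_{d_i i}` and `K_{-d_i i}`. -/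
def cartanElt (D : SuperRootDatum C Y X) (i : I) (k : Bool) : Multiplicative (Y × Y) :=
  Multiplicative.ofAdd (bif k then (C.d i • D.coroot i, C.d i • D.coroot i)
    else (-(C.d i • D.coroot i), 0))

/-- The scalar `(π_i q_i - q_i⁻¹)⁻¹`. -/
def cartanCoeff (C : SuperCartanDatum I) (i : I) : Qqpi :=
  Ring.inverse (((C.pii i * C.qi i : Qqpiˣ) : Qqpi) - (((C.qi i)⁻¹ : Qqpiˣ) : Qqpi))

open Classical in
/-- Elements `e_i`, `f_i`, `G(μ, ν)` of an algebra satisfy the relations of `E_i`, `F_i`,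
`J_ν K_μ`. -/
structure CoveringRels (D : SuperRootDatum C Y X) {W : Type*} [Ring W] [Algebra Qqpi W]
    (e f : I → W) (G : Multiplicative (Y × Y) →* W) : Prop where
  G_two : ∀ ν, G (Multiplicative.ofAdd (0, 2 • ν)) = 1
  G_e : ∀ γ i, G γ * e i = ((character D γ i : Qqpiˣ) : Qqpi) • (e i * G γ)
  G_f : ∀ γ i, G γ * f i = (((character D γ i)⁻¹ : Qqpiˣ) : Qqpi) • (f i * G γ)
  e_f : ∀ i j, e i * f j - parityFactor C i j • (f j * e i) =
    if i = j then cartanCoeff C i • (G (cartanElt D i true) - G (cartanElt D i false)) else 0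

/-- The relations among the `J_μ` and `K_μ`, apart from `J_{2μ} = 1`, express that `G` is a
homomorphism from a commutative monoid; the others are special cases of the fields of
`CoveringRels`. -/
theorem CoveringRels.genMap_eq {D : SuperRootDatum C Y X} {W : Type*} [Ring W] [Algebra Qqpi W]
    {e f : I → W} {G : Multiplicative (Y × Y) →* W} (h : CoveringRels D e f G)
    {x y : FreeU I Y} (hxy : PreRel D x y) : genMap e f G x = genMap e f G y := by
  have hG : ∀ a b : Y × Y, G (Multiplicative.ofAdd a) * G (Multiplicative.ofAdd b) =
      G (Multiplicative.ofAdd (a + b)) := fun a b => (map_mul G _ _).symm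
  cases hxy with
  | K_zero =>
    rw [genMap_K, map_one]
    exact G.map_one
  | K_add μ ν => simp only [map_mul, genMap_K, hG, Prod.mk_add_mk, add_zero]
  | J_two μ => rw [genMap_J, map_one, h.G_two]
  | J_add μ ν => simp only [map_mul, genMap_J, hG, Prod.mk_add_mk, add_zero]
  | J_K μ ν => simp only [map_mul, genMap_J, genMap_K, hG, Prod.mk_add_mk, add_zero, zero_add]
  | K_E μ i =>
    simp only [map_mul, map_smul, genMap_K, genMap_E, h.G_e]
    simp [character]
  | J_E μ i =>
    simp only [map_mul, map_smul, genMap_J, genMap_E, h.G_e]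
    simp [character]
  | K_F μ i =>
    simp only [map_mul, map_smul, genMap_K, genMap_F, h.G_f]
    simp [character]
  | J_F μ i =>
    simp only [map_mul, map_smul, genMap_J, genMap_F, h.G_f]
    simp [character]
  | E_F_same i =>
    have h' := h.e_f i i
    rw [if_pos rfl] at h'
    simp only [map_mul, map_smul, map_sub, genMap_J, genMap_K, genMap_E, genMap_F, hG,
      Prod.mk_add_mk, add_zero, zero_add]
    exact h'
  | E_F_ne i j hij =>
    have h' := h.e_f i j
    rw [if_neg hij] at h'
    simp only [map_mul, map_smul, map_sub, genMap_E, genMap_F, map_zero]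
    exact h'

/-- The relations hold in every algebra to which `'U` maps. -/
theorem coveringRels_of_hom (D : SuperRootDatum C Y X) {U : Type*} [Ring U] [Algebra Qqpi U]
    (mk : FreeU I Y →ₐ[Qqpi] U) (hmk : ∀ x y, PreRel D x y → mk x = mk y)
    (b : UZero Y →ₐ[Qqpi] U) (hJ : ∀ μ, b (UZero.J μ) = mk (FreeU.J I μ))
    (hK : ∀ μ, b (UZero.K μ) = mk (FreeU.K I μ)) :
    CoveringRels D (fun i => mk (FreeU.E Y i)) (fun i => mk (FreeU.F Y i))
      ((b : UZero Y →* U).comp UZero.grouplike) where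
  G_two ν := by
    rw [MonoidHom.comp_apply, UZero.grouplike_two, map_one]
  G_e γ i := by
    have hK' := hmk _ _ (PreRel.K_E γ.toAdd.1 i)
    have hJ' := hmk _ _ (PreRel.J_E γ.toAdd.2 i)
    simp only [map_mul, map_smul] at hK' hJ'
    have hg : ((b : UZero Y →* U).comp UZero.grouplike) γ =
        mk (FreeU.J I γ.toAdd.2) * mk (FreeU.K I γ.toAdd.1) := by
      rw [← hJ, ← hK, ← map_mul]
      rfl
    rw [hg, mul_assoc, hK', mul_smul_comm, ← mul_assoc, hJ', smul_mul_assoc, smul_smul, mul_assoc,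
      ← Units.val_mul]
    rfl
  G_f γ i := by
    have hK' := hmk _ _ (PreRel.K_F γ.toAdd.1 i)
    have hJ' := hmk _ _ (PreRel.J_F γ.toAdd.2 i)
    simp only [map_mul, map_smul] at hK' hJ'
    have hg : ((b : UZero Y →* U).comp UZero.grouplike) γ =
        mk (FreeU.J I γ.toAdd.2) * mk (FreeU.K I γ.toAdd.1) := by
      rw [← hJ, ← hK, ← map_mul]
      rfl
    have hc : (character D γ i)⁻¹ = q ^ (-D.pairing γ.toAdd.1 (D.root i)) *
        pi ^ (-D.pairing γ.toAdd.2 (D.root i)) := by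
      rw [zpow_neg, zpow_neg, ← mul_inv]
      rfl
    rw [hg, mul_assoc, hK', mul_smul_comm, ← mul_assoc, hJ', smul_mul_assoc, smul_smul, mul_assoc,
      ← Units.val_mul, hc]
  e_f i j := by
    by_cases hij : i = j
    · subst hij
      have h := hmk _ _ (PreRel.E_F_same i)
      simp only [map_mul, map_smul, map_sub] at h
      rw [if_pos rfl]
      refine h.trans ?_
      rw [← hJ, ← hK, ← hK, ← UZero.grouplike_K (-_), ← map_mul]
      rfl
    · have h := hmk _ _ (PreRel.E_F_ne i j hij)
      simp only [map_mul, map_smul, map_sub, map_zero] at h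
      rw [if_neg hij]
      exact h

/-! ## The triangular data of `'U` and `U` -/

/-- The automorphism `K_μ ↦ χ(μ, 0) K_μ`, `J_ν ↦ χ(0, ν) J_ν` of `U⁰`. -/
def UZero.scale (χ : Multiplicative (Y × Y) →* Qqpiˣ)
    (hχ : ∀ ν, χ (Multiplicative.ofAdd (0, 2 • ν)) = 1) : UZero Y →ₐ[Qqpi] UZero Y :=
  UZero.lift
    { toFun := fun γ => ((χ γ : Qqpiˣ) : Qqpi) • UZero.grouplike γ
      map_one' := by simp
      map_mul' := fun γ γ' => by
        rw [map_mul, map_mul, Units.val_mul, smul_mul_smul_comm] }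
    fun ν => by simpa [hχ] using UZero.grouplike_two ν

theorem UZero.scale_grouplike (χ : Multiplicative (Y × Y) →* Qqpiˣ) (hχ)
    (γ : Multiplicative (Y × Y)) :
    UZero.scale χ hχ (UZero.grouplike γ) = ((χ γ : Qqpiˣ) : Qqpi) • UZero.grouplike γ :=
  UZero.lift_grouplike _ _ γ

/-- A quotient of `'f` by an ideal that is stable under the rescalings and skew derivations which
occur in the commutation relations of `'U`. -/
structure StableQuotient (D : SuperRootDatum C Y X) {N : Type*} [Ring N] [Algebra Qqpi N]
    (p : FreeHalf I →ₐ[Qqpi] N) : Prop where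
  surjective : Function.Surjective p
  scale : ∀ φ x, p x = 0 → p (scale φ x) = 0
  deriv_left : ∀ (s : ℤˣ) i k x, p x = 0 → p (skewDeriv i (parityFactor C i)
    (fun j => (((character D (cartanElt D i k) j ^ (s : ℤ))⁻¹ : Qqpiˣ) : Qqpi)) x) = 0
  deriv_right : ∀ (s : ℤˣ) i k x, p x = 0 → p (skewDeriv i
    (fun j => (((character D (cartanElt D i k) j ^ (s : ℤ))⁻¹ : Qqpiˣ) : Qqpi)) (parityFactor C i) x) = 0

variable {D : SuperRootDatum C Y X} {N : Type*} [Ring N] [Algebra Qqpi N]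
  {p : FreeHalf I →ₐ[Qqpi] N}

/-- The triangular datum of `'U` or `U`; the sign `s` tells which of `E_i` (`s = 1`) and `F_i`
(`s = -1`) is the upper part. -/
def StableQuotient.datum (hp : StableQuotient D p) (s : ℤˣ) (coeff : I → Qqpi) :
    TriangularDatum Qqpi I Bool (Multiplicative (Y × Y)) (UZero Y) N N where
  ε := parityFactor C
  ψ := (zpowGroupHom (s : ℤ)).comp (character D)
  g := UZero.grouplike
  span_g := UZero.span_grouplike
  s i := UZero.scale
    ((zpowGroupHom (-(s : ℤ))).comp ((Pi.evalMonoidHom (fun _ => Qqpiˣ) i).comp (character D)))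
    fun ν => by simp [character_two]
  s_g i γ := by
    rw [UZero.scale_grouplike]
    simp
  coeff i k := bif k then coeff i else -coeff i
  elt := cartanElt D
  lower := p
  upper := p
  lower_surj := hp.surjective
  upper_surj := hp.surjective
  scale_lower := hp.scale
  scale_upper := hp.scale
  deriv_lower i k x hx := hp.deriv_left s i k x hx
  deriv_upper i k x hx := by
    simp only [parityFactor_comm _ i]
    exact hp.deriv_right s i k x hx

theorem eq_smul_iff_inv_smul_eq {R M : Type*} [CommRing R] [AddCommGroup M] [Module R M] (c : Rˣ)
    (x y : M) : x = ((c⁻¹ : Rˣ) : R) • y ↔ y = (c : R) • x := by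
  rw [← Units.smul_def, ← Units.smul_def, eq_inv_smul_iff, eq_comm]

/-- Both directions are used: one turns the operators of the datum into a representation of the
presented algebra, the other supplies the straightening relations inside that algebra. -/
theorem rels_datum_one_iff (hp : StableQuotient D p) {W : Type*} [Ring W] [Algebra Qqpi W]
    {e f : I → W} {G : Multiplicative (Y × Y) →* W}
    (hG : ∀ ν, G (Multiplicative.ofAdd (0, 2 • ν)) = 1) :
    (hp.datum 1 (cartanCoeff C)).Rels e f G ↔ CoveringRels D e f G := by
  have hc : ∀ i, (∑ k, (hp.datum 1 (cartanCoeff C)).coeff i k •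
      G ((hp.datum 1 (cartanCoeff C)).elt i k)) =
      cartanCoeff C i • (G (cartanElt D i true) - G (cartanElt D i false)) := by
    intro i
    simp [StableQuotient.datum, sub_eq_add_neg]
  have hw : ∀ γ i, (hp.datum 1 (cartanCoeff C)).wt γ i =
      (((character D γ i)⁻¹ : Qqpiˣ) : Qqpi) := by
    intro γ i
    simp [StableQuotient.datum, TriangularDatum.wt]
  constructor
  · intro h
    refine ⟨hG, fun γ i => ?_, fun γ i => ?_, fun i j => ?_⟩
    · have h' := h.G_upper γ i
      rwa [hw, eq_smul_iff_inv_smul_eq] at h'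
    · have h' := h.G_lower γ i
      rwa [hw] at h'
    · have h' := h.comm i j
      rwa [hc] at h'
  · intro h
    refine ⟨fun i j => ?_, fun γ i => ?_, fun γ i => ?_⟩
    · rw [hc]
      exact h.e_f i j
    · rw [hw]
      exact h.G_f γ i
    · rw [hw, eq_smul_iff_inv_smul_eq]
      exact h.G_e γ i

/-- Exchanging `E` and `F` inverts the character, whence the sign `-1`. Multiplying the relation for
`e_i f_i` by minus the parity factor, whose square is `1`, gives the one for `f_i e_i`; this
explains the coefficient. -/
theorem rels_datum_neg_one_iff (hp : StableQuotient D p) {W : Type*} [Ring W] [Algebra Qqpi W]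
    {e f : I → W} {G : Multiplicative (Y × Y) →* W}
    (hG : ∀ ν, G (Multiplicative.ofAdd (0, 2 • ν)) = 1) :
    (hp.datum (-1) (fun i => -(parityFactor C i i * cartanCoeff C i))).Rels f e G ↔
      CoveringRels D e f G := by
  set P := hp.datum (-1) (fun i => -(parityFactor C i i * cartanCoeff C i)) with hP
  have hc : ∀ i, (∑ k, P.coeff i k • G (P.elt i k)) = -(parityFactor C i i •
      cartanCoeff C i • (G (cartanElt D i true) - G (cartanElt D i false))) := by
    intro i
    simp [hP, StableQuotient.datum, sub_eq_add_neg, smul_smul, add_comm]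
  have hw : ∀ γ i, P.wt γ i = ((character D γ i : Qqpiˣ) : Qqpi) := by
    intro γ i
    simp [hP, StableQuotient.datum, TriangularDatum.wt]
  have hε : ∀ i j, f i * e j - P.ε i j • (e j * f i) =
      -(parityFactor C i j • (e j * f i - parityFactor C j i • (f i * e j))) := by
    intro i j
    rw [parityFactor_comm j i, smul_sub, smul_smul, parityFactor_mul_self, one_smul, neg_sub]
    rfl
  have hinj : ∀ i j, ∀ a b : W, -(parityFactor C i j • a) = -(parityFactor C i j • b) ↔ a = b := by
    intro i j a b
    rw [neg_inj]
    refine ⟨fun h => ?_, fun h => by rw [h]⟩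
    have h' := congrArg (parityFactor C i j • ·) h
    simpa only [smul_smul, parityFactor_mul_self, one_smul] using h'
  constructor
  · intro h
    refine ⟨hG, fun γ i => ?_, fun γ i => ?_, fun i j => ?_⟩
    · have h' := h.G_lower γ i
      rwa [hw] at h'
    · have h' := h.G_upper γ i
      rwa [hw, ← eq_smul_iff_inv_smul_eq] at h'
    · have h' := h.comm j i
      rw [hc, hε] at h'
      by_cases hij : i = j
      · subst hij
        rw [if_pos rfl, hinj] at h'
        rw [h', if_pos rfl]
      · rw [if_neg (Ne.symm hij), neg_eq_zero, ← smul_zero (parityFactor C j i), ← neg_inj,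
          hinj] at h'
        rw [h', if_neg hij]
  · intro h
    refine ⟨fun i j => ?_, fun γ i => ?_, fun γ i => ?_⟩
    · rw [hc, hε, h.e_f j i]
      by_cases hij : i = j
      · subst hij
        rw [if_pos rfl, if_pos rfl]
      · rw [if_neg hij, if_neg (Ne.symm hij), smul_zero, neg_zero]
    · rw [hw]
      exact h.G_e γ i
    · rw [hw, ← eq_smul_iff_inv_smul_eq]
      exact h.G_f γ i

/-- Both triangular decompositions of an algebra `U` that is presented by the relations of `'U` and
the elements of the kernel of `p`. -/
theorem StableQuotient.bijective_tripleMul (hp : StableQuotient D p) {U : Type*} [Ring U]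
    [Algebra Qqpi U] (mk : FreeU I Y →ₐ[Qqpi] U) (hsurj : Function.Surjective mk)
    (hmk : ∀ x y, PreRel D x y → mk x = mk y)
    (hlift : ∀ Φ : FreeU I Y →ₐ[Qqpi] TripleEnd Qqpi N (UZero Y) N,
      (∀ x y, PreRel D x y → Φ x = Φ y) →
      (∀ x, p x = 0 → Φ (FreeAlgebra.lift Qqpi (FreeU.E Y) x) = 0) →
      (∀ x, p x = 0 → Φ (FreeAlgebra.lift Qqpi (FreeU.F Y) x) = 0) →
      ∃ ρ : U →ₐ[Qqpi] TripleEnd Qqpi N (UZero Y) N, ∀ x, ρ (mk x) = Φ x)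
    (a : N →ₐ[Qqpi] U) (b : UZero Y →ₐ[Qqpi] U) (c : N →ₐ[Qqpi] U)
    (ha : ∀ i, a (p (θ i)) = mk (FreeU.F Y i)) (hJ : ∀ μ, b (UZero.J μ) = mk (FreeU.J I μ))
    (hK : ∀ μ, b (UZero.K μ) = mk (FreeU.K I μ)) (hc : ∀ i, c (p (θ i)) = mk (FreeU.E Y i)) :
    Function.Bijective (tripleMul a b c) ∧ Function.Bijective (tripleMul c b a) := by
  have hU := coveringRels_of_hom D mk hmk b hJ hK
  have hgen : ∀ S : Subalgebra Qqpi U, (∀ i, mk (FreeU.E Y i) ∈ S) → (∀ i, mk (FreeU.F Y i) ∈ S) →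
      (∀ γ, b (UZero.grouplike γ) ∈ S) → S = ⊤ := by
    intro S h1 h2 h3
    refine eq_top_of_gen_mem mk hsurj S fun z => ?_
    cases z with
    | E i => exact h1 i
    | F i => exact h2 i
    | J μ => exact hJ μ ▸ UZero.grouplike_J μ ▸ h3 (Multiplicative.ofAdd (0, μ))
    | K μ => exact hK μ ▸ UZero.grouplike_K μ ▸ h3 (Multiplicative.ofAdd (μ, 0))
  have hρG : ∀ (ρ : U →ₐ[Qqpi] TripleEnd Qqpi N (UZero Y) N) 
      (e f : I → TripleEnd Qqpi N (UZero Y) N)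
      (G : Multiplicative (Y × Y) →* TripleEnd Qqpi N (UZero Y) N), (∀ x, ρ (mk x) = genMap e f G x) →
      ∀ γ, ρ (b (UZero.grouplike γ)) = G γ := by
    intro ρ e f G h γ
    have h1 : b (UZero.grouplike γ) = b (UZero.J γ.toAdd.2) * b (UZero.K γ.toAdd.1) :=
      map_mul b _ _
    rw [h1, map_mul, hJ, hK, h, h, genMap_J, genMap_K, ← map_mul, ← ofAdd_add]
    simp
  constructor
  · let P := hp.datum 1 (cartanCoeff C)
    let G : Multiplicative (Y × Y) →* TripleEnd Qqpi N (UZero Y) N :=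
      { toFun := P.opG, map_one' := P.opG_one, map_mul' := P.opG_mul }
    have hG : ∀ ν, G (Multiplicative.ofAdd (0, 2 • ν)) = 1 := fun ν =>
      P.opG_eq_one (by simp [P, StableQuotient.datum, character_two]) (UZero.grouplike_two ν)
    have hrel : CoveringRels D P.opA P.opB G := (rels_datum_one_iff hp hG).mp P.rels_op
    obtain ⟨ρ, hρ⟩ := hlift (genMap P.opA P.opB G) (fun _ _ => hrel.genMap_eq)
      (fun x hx => by rw [genMap_lift_E]; exact P.lift_opA_eq_zero hx)
      (fun x hx => by rw [genMap_lift_F]; exact P.lift_opB_eq_zero hx)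
    have hA : (fun i => c (P.upper (θ i))) = fun i => mk (FreeU.E Y i) := funext hc
    have hB : (fun i => a (P.lower (θ i))) = fun i => mk (FreeU.F Y i) := funext ha
    refine P.bijective_tripleMul a b c ?_ ρ (fun i => ?_) (fun i => ?_)
      (hρG ρ P.opA P.opB G hρ) (hgen _ (fun i => ?_) (fun i => ?_) fun γ => ?_)
    · rw [hA, hB]
      exact (rels_datum_one_iff hp hU.G_two).mpr hU
    · exact (congrArg ρ (hc i)).trans ((hρ _).trans (genMap_E _ _ _ i))
    · exact (congrArg ρ (ha i)).trans ((hρ _).trans (genMap_F _ _ _ i))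
    · exact Algebra.subset_adjoin (Or.inl (Or.inl ⟨i, hc i⟩))
    · exact Algebra.subset_adjoin (Or.inl (Or.inr ⟨i, ha i⟩))
    · exact Algebra.subset_adjoin (Or.inr ⟨γ, rfl⟩)
  -- For the opposite order, the `F_i` act as the upper generators and the `E_i` as the lower ones.
  · let P := hp.datum (-1) (fun i => -(parityFactor C i i * cartanCoeff C i))
    let G : Multiplicative (Y × Y) →* TripleEnd Qqpi N (UZero Y) N :=
      { toFun := P.opG, map_one' := P.opG_one, map_mul' := P.opG_mul }
    have hG : ∀ ν, G (Multiplicative.ofAdd (0, 2 • ν)) = 1 := fun ν =>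
      P.opG_eq_one (by simp [P, StableQuotient.datum, character_two]) (UZero.grouplike_two ν)
    have hrel : CoveringRels D P.opB P.opA G := (rels_datum_neg_one_iff hp hG).mp P.rels_op
    obtain ⟨ρ, hρ⟩ := hlift (genMap P.opB P.opA G) (fun _ _ => hrel.genMap_eq)
      (fun x hx => by rw [genMap_lift_E]; exact P.lift_opB_eq_zero hx)
      (fun x hx => by rw [genMap_lift_F]; exact P.lift_opA_eq_zero hx)
    have hA : (fun i => a (P.upper (θ i))) = fun i => mk (FreeU.F Y i) := funext ha
    have hB : (fun i => c (P.lower (θ i))) = fun i => mk (FreeU.E Y i) := funext hc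
    refine P.bijective_tripleMul c b a ?_ ρ (fun i => ?_) (fun i => ?_)
      (hρG ρ P.opB P.opA G hρ) (hgen _ (fun i => ?_) (fun i => ?_) fun γ => ?_)
    · rw [hA, hB]
      exact (rels_datum_neg_one_iff hp hU.G_two).mpr hU
    · exact (congrArg ρ (ha i)).trans ((hρ _).trans (genMap_F _ _ _ i))
    · exact (congrArg ρ (hc i)).trans ((hρ _).trans (genMap_E _ _ _ i))
    · exact Algebra.subset_adjoin (Or.inl (Or.inr ⟨i, hc i⟩))
    · exact Algebra.subset_adjoin (Or.inl (Or.inl ⟨i, ha i⟩))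
    · exact Algebra.subset_adjoin (Or.inr ⟨γ, rfl⟩)

end Concrete

section Decompositions

variable {I : Type u} [Fintype I] {C : SuperCartanDatum I} {Y : Type v} {X : Type w}
  [AddCommGroup Y] [AddCommGroup X] (D : SuperRootDatum C Y X)

/-! ## Triangular decompositions of `'U` -/

/-- The kernel is zero, so stability is automatic; this is why `'U` needs no evenness assumption. -/
theorem stableQuotient_id : StableQuotient D (AlgHom.id Qqpi (FreeHalf I)) where
  surjective := Function.surjective_id
  scale φ x hx := by
    obtain rfl : x = 0 := hx
    simp
  deriv_left s i k x hx := by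
    obtain rfl : x = 0 := hx
    simp
  deriv_right s i k x hx := by
    obtain rfl : x = 0 := hx
    simp

theorem bijective_tripleMul_preU :
    Function.Bijective (tripleMul (preMinus D) (preZero D) (prePlus D)) ∧
      Function.Bijective (tripleMul (prePlus D) (preZero D) (preMinus D)) := by
  refine (stableQuotient_id D).bijective_tripleMul (RingQuot.mkAlgHom Qqpi (PreRel D))
    (RingQuot.mkAlgHom_surjective Qqpi _) (fun x y h => RingQuot.mkAlgHom_rel Qqpi h)
    (fun Φ hΦ _ _ => ⟨RingQuot.liftAlgHom Qqpi ⟨Φ, fun x y h => hΦ x y h⟩, fun x =>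
      RingQuot.liftAlgHom_mkAlgHom_apply Qqpi Φ _ x⟩) _ _ _ ?_ ?_ ?_ ?_
  · intro i
    simp [preMinus]
  · intro μ
    simp [preZero, UZero.J, freeZero, RingQuot.liftAlgHom_mkAlgHom_apply]
  · intro μ
    simp [preZero, UZero.K, freeZero, RingQuot.liftAlgHom_mkAlgHom_apply]
  · intro i
    simp [prePlus]

/-! ## Triangular decompositions of `U` -/

theorem two_mul_d (i : I) : 2 * C.d i = C.dot i i := by
  obtain ⟨k, hk⟩ := C.dot_self_even i
  unfold SuperCartanDatum.d
  omega

theorem pairing_d_coroot (i j : I) :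
    D.pairing (C.d i • D.coroot i) (D.root j) = C.dot i j := by
  have h := D.pairing_coroot_root i j
  rw [← two_mul_d] at h
  rw [map_smul, LinearMap.smul_apply, smul_eq_mul]
  linarith

theorem chi_eq (i j : I) :
    C.chi i j = ((q ^ C.dot i j : Qqpiˣ) : Qqpi) * parityFactor C i j := by
  rw [SuperCartanDatum.chi, Units.val_mul, parityFactor]

/-- The element `J_{d_i i}` contributes `π ^ (i · j)`, which is `1` because `i · j` is even; only a
power of `q` remains. This is where the evenness assumption enters. The sign `m` collects the choice
of Cartan element, the sign `s` and the inversion. -/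
theorem character_cartanElt (hC : ∀ i j, Even (C.dot i j)) (s : ℤˣ) (i : I) (k : Bool) :
    ∃ m : ℤ, (m = 1 ∨ m = -1) ∧
      ∀ j, (character D (cartanElt D i k) j ^ (s : ℤ))⁻¹ = q ^ (m * C.dot i j) := by
  have h : ∃ m : ℤ, (m = 1 ∨ m = -1) ∧
      ∀ j, character D (cartanElt D i k) j = q ^ (m * C.dot i j) := by
    cases k with
    | true =>
      refine ⟨1, Or.inl rfl, fun j => ?_⟩
      have h' : character D (cartanElt D i true) j =
        q ^ D.pairing (C.d i • D.coroot i) (D.root j) *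
          pi ^ D.pairing (C.d i • D.coroot i) (D.root j) := rfl
      rw [h', pairing_d_coroot, pi_zpow_even _ (hC i j), mul_one, one_mul]
    | false =>
      refine ⟨-1, Or.inr rfl, fun j => ?_⟩
      have h' : character D (cartanElt D i false) j =
        q ^ D.pairing (-(C.d i • D.coroot i)) (D.root j) * pi ^ D.pairing 0 (D.root j) := rfl
      rw [h', map_neg, LinearMap.neg_apply, pairing_d_coroot, map_zero, LinearMap.zero_apply,
        zpow_zero, mul_one, neg_one_mul]
  obtain ⟨m, hm, h⟩ := h
  refine ⟨-(m * s), ?_, fun j => ?_⟩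
  · rcases hm with rfl | rfl <;> rcases Int.units_eq_one_or s with rfl | rfl <;> simp
  · rw [h, ← zpow_mul, ← zpow_neg]
    congr 1
    ring

theorem q_zpow_mul_neg (n : ℤ) : ((q ^ (-n) : Qqpiˣ) : Qqpi) * ((q ^ n : Qqpiˣ) : Qqpi) = 1 := by
  rw [← Units.val_mul, ← zpow_add, neg_add_cancel, zpow_zero, Units.val_one]

/-- The two parameters of the skew derivation are the parity factor `ε` and `q ^ (m (i · j))` with
`m = ±1`. As `χ = q ^ (i · j) ε` and `ε² = 1`, one parameter is always `χ` times the other, and the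
sign `m` decides which. -/
theorem stableQuotient_half (hC : ∀ i j, Even (C.dot i j)) :
    StableQuotient D (Ideal.Quotient.mkₐ Qqpi (radical C)) where
  surjective := Ideal.Quotient.mkₐ_surjective Qqpi _
  scale φ x hx := by
    rw [Ideal.Quotient.mkₐ_eq_mk, Ideal.Quotient.eq_zero_iff_mem] at hx ⊢
    exact scale_mem_radical C φ hx
  deriv_left s i k x hx := by
    rw [Ideal.Quotient.mkₐ_eq_mk, Ideal.Quotient.eq_zero_iff_mem] at hx ⊢
    obtain ⟨m, rfl | rfl, h⟩ := character_cartanElt D hC s i k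
    -- For `m = 1`, the power of `q` equals `ε χ`.
    · convert skewDeriv_mem_radical' C i (parityFactor C i) hx using 3
      funext j
      rw [h, Pi.mul_apply, chi_eq, mul_left_comm, parityFactor_mul_self, one_mul, mul_one]
    -- For `m = -1`, the parity factor equals `q ^ (-(i · j)) χ`.
    · convert skewDeriv_mem_radical C i
        (fun j => (((character D (cartanElt D i k) j ^ (s : ℤ))⁻¹ : Qqpiˣ) : Qqpi)) hx using 3
      funext j
      rw [Pi.mul_apply, h, chi_eq, ← mul_assoc, neg_one_mul, q_zpow_mul_neg, one_mul]
  deriv_right s i k x hx := by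
    rw [Ideal.Quotient.mkₐ_eq_mk, Ideal.Quotient.eq_zero_iff_mem] at hx ⊢
    obtain ⟨m, rfl | rfl, h⟩ := character_cartanElt D hC s i k
    · convert skewDeriv_mem_radical C i (parityFactor C i) hx using 3
      funext j
      rw [h, Pi.mul_apply, chi_eq, mul_left_comm, parityFactor_mul_self, one_mul, mul_one]
    · convert skewDeriv_mem_radical' C i
        (fun j => (((character D (cartanElt D i k) j ^ (s : ℤ))⁻¹ : Qqpiˣ) : Qqpi)) hx using 3
      funext j
      rw [Pi.mul_apply, h, chi_eq, ← mul_assoc, neg_one_mul, q_zpow_mul_neg, one_mul]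

theorem bijective_tripleMul_coveringU (hC : ∀ i j, Even (C.dot i j)) :
    Function.Bijective (tripleMul (minus D) (zero D) (plus D)) ∧
      Function.Bijective (tripleMul (plus D) (zero D) (minus D)) := by
  refine (stableQuotient_half D hC).bijective_tripleMul (RingQuot.mkAlgHom Qqpi (Rel D))
    (RingQuot.mkAlgHom_surjective Qqpi _)
    (fun x y h => RingQuot.mkAlgHom_rel Qqpi (Rel.pre x y h))
    (fun Φ hΦ hE hF => ⟨RingQuot.liftAlgHom Qqpi ⟨Φ, fun x y h => ?_⟩, fun x =>
      RingQuot.liftAlgHom_mkAlgHom_apply Qqpi Φ _ x⟩) _ _ _ ?_ ?_ ?_ ?_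
  · cases h with
    | pre _ _ h => exact hΦ _ _ h
    | radical_E f hf => rw [map_zero, hE f (Ideal.Quotient.eq_zero_iff_mem.mpr hf)]
    | radical_F f hf => rw [map_zero, hF f (Ideal.Quotient.eq_zero_iff_mem.mpr hf)]
  · intro i
    exact congrArg _ (FreeAlgebra.lift_ι_apply _ i)
  · intro μ
    simp [zero, UZero.J, freeZero, RingQuot.liftAlgHom_mkAlgHom_apply]
  · intro μ
    simp [zero, UZero.K, freeZero, RingQuot.liftAlgHom_mkAlgHom_apply]
  · intro i
    exact congrArg _ (FreeAlgebra.lift_ι_apply _ i)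

end Decompositions

/-! ## Injectivity of the factors -/

section Factors

variable {R A B A' U : Type*} [CommRing R] [Ring A] [Ring B] [Ring A'] [Ring U] [Algebra R A]
  [Algebra R B] [Algebra R A'] [Algebra R U] {a : A →ₐ[R] U} {b : B →ₐ[R] U} {c : A' →ₐ[R] U}

/-- The characters `εA` and `εB` give a left inverse of `x ↦ 1 ⊗ 1 ⊗ x`, so no freeness or flatness
of the factors is needed. -/
theorem injective_right_of_tripleMul (h : Function.Injective (tripleMul a b c)) (εA : A →ₐ[R] R)
    (εB : B →ₐ[R] R) : Function.Injective c := by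
  intro x x' hx
  have h1 : tripleMul a b c ((1 ⊗ₜ 1) ⊗ₜ x) = tripleMul a b c ((1 ⊗ₜ 1) ⊗ₜ x') := by
    simp [tripleMul, hx]
  have h2 := congrArg (TensorProduct.lid R A' ∘ TensorProduct.map
    (LinearMap.mul' R R ∘ₗ TensorProduct.map εA.toLinearMap εB.toLinearMap) LinearMap.id) (h h1)
  simpa using h2

theorem injective_middle_of_tripleMul (h : Function.Injective (tripleMul a b c)) (εA : A →ₐ[R] R)
    (εA' : A' →ₐ[R] R) : Function.Injective b := by
  intro x x' hx
  have h1 : tripleMul a b c ((1 ⊗ₜ x) ⊗ₜ 1) = tripleMul a b c ((1 ⊗ₜ x') ⊗ₜ 1) := by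
    simp [tripleMul, hx]
  have h2 := congrArg (TensorProduct.rid R B ∘ TensorProduct.map
    ((TensorProduct.lid R B).toLinearMap ∘ₗ TensorProduct.map εA.toLinearMap LinearMap.id)
    εA'.toLinearMap) (h h1)
  simpa using h2

end Factors

end QuantumCovering

end

/-! ### The proposition and its corollary -/

theorem mainTheorem4 {I : Type*} [Fintype I] (C : QuantumCovering.SuperCartanDatum I)
    {Y X : Type*} [AddCommGroup Y] [AddCommGroup X] (D : QuantumCovering.SuperRootDatum C Y X) :
    -- `U⁰` is the group algebra of `Y × Y/2Y`
    (∃ e : QuantumCovering.UZero Y ≃ₐ[QuantumCovering.Qqpi]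
        AddMonoidAlgebra QuantumCovering.Qqpi (Y × (Y ⧸ QuantumCovering.twoMul Y)),
      (∀ μ : Y, e (QuantumCovering.UZero.K μ) = AddMonoidAlgebra.single (μ, 0) 1) ∧
      ∀ ν : Y, e (QuantumCovering.UZero.J ν) =
        AddMonoidAlgebra.single (0, (QuotientAddGroup.mk ν : Y ⧸ QuantumCovering.twoMul Y)) 1) ∧
    -- triangular decompositions of `'U`
    Function.Bijective (QuantumCovering.tripleMul (QuantumCovering.preMinus D)
      (QuantumCovering.preZero D) (QuantumCovering.prePlus D)) ∧
    Function.Bijective (QuantumCovering.tripleMul (QuantumCovering.prePlus D)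
      (QuantumCovering.preZero D) (QuantumCovering.preMinus D)) ∧
    -- triangular decompositions of `U`, when `i · j` is even for all `i`, `j`
    ((∀ i j : I, Even (C.dot i j)) →
      Function.Bijective (QuantumCovering.tripleMul (QuantumCovering.minus D)
        (QuantumCovering.zero D) (QuantumCovering.plus D)) ∧
      Function.Bijective (QuantumCovering.tripleMul (QuantumCovering.plus D)
        (QuantumCovering.zero D) (QuantumCovering.minus D)) ∧
      (∃ e : QuantumCovering.Half C ≃ₐ[QuantumCovering.Qqpi] QuantumCovering.UPlus D,
        ∀ x, (e x : QuantumCovering.CoveringU D) = QuantumCovering.plus D x) ∧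
      (∃ e : QuantumCovering.Half C ≃ₐ[QuantumCovering.Qqpi] QuantumCovering.UMinus D,
        ∀ x, (e x : QuantumCovering.CoveringU D) = QuantumCovering.minus D x) ∧
      Function.Injective (QuantumCovering.zero D)) := by
  refine ⟨⟨QuantumCovering.UZero.equivGroupAlgebra, QuantumCovering.UZero.toGroupAlgebra_K,
    QuantumCovering.UZero.toGroupAlgebra_J⟩, (QuantumCovering.bijective_tripleMul_preU D).1,
    (QuantumCovering.bijective_tripleMul_preU D).2, fun hC => ?_⟩
  obtain ⟨h₁, h₂⟩ := QuantumCovering.bijective_tripleMul_coveringU D hC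
  have hplus := QuantumCovering.injective_right_of_tripleMul h₁.1 (QuantumCovering.halfCounit C)
    QuantumCovering.UZero.counit
  -- In the second decomposition the right-hand factor is the negative part.
  have hminus := QuantumCovering.injective_right_of_tripleMul h₂.1 (QuantumCovering.halfCounit C)
    QuantumCovering.UZero.counit
  exact ⟨h₁, h₂, ⟨AlgEquiv.ofInjective _ hplus, fun _ => rfl⟩,
    ⟨AlgEquiv.ofInjective _ hminus, fun _ => rfl⟩,
    QuantumCovering.injective_middle_of_tripleMul h₁.1 (QuantumCovering.halfCounit C)
      (QuantumCovering.halfCounit C)⟩
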